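/- Let $K/F$ be a finite Galois extension of number fields with Galois group $G$. Write $U_K=\mathcal{O}_K^\times$, and let $I(K)$, $P(K)$ and $\mathrm{Cl}(K)=I(K)/P(K)$ be the groups of fractional ideals, of principal fractional ideals and of ideal classes of $K$. Let $\mathrm{Po}(K/F)\subseteq\mathrm{Cl}(K)$ be the relative Pólya group, i.e. the subgroup generated by the classes of the ideals $$\Pi_{\mathfrak p^f}(K/F)=\prod_{\mathfrak P:\ N_{K/F}(\mathfrak P)=\mathfrak p^f}\mathfrak P ,$$ where $\mathfrak p$ runs over the nonzero primes of $F$, $f$ over the positive integers, and $\mathfrak P$ over the nonzero primes of $K$ (an empty product is $\mathcal{O}_K$). Let $\epsilon_{K/F}:\mathrm{Cl}(F)\to\mathrm{Cl}(K)$ be the map induced by extension of ideals, and let $$\mathrm{Ost}(K/F)=\mathrm{Po}(K/F)/\bigl(\mathrm{Po}(K/F)\cap\epsilon_{K/F}(\mathrm{Cl}(F))\bigr)$$ be the Ostrowski quotient. Let $\mathrm{Cl}(K)^G_{\mathrm{trans}}$ be the group of transgressive ambiguous classes, i.e. the kernel of the composite $$\mathrm{Cl}(K)^G\to H^1(G,P(K))\to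 H^2(G,U_K)$$ of the connecting homomorphisms of the exact sequences of $G$-modules $0\to P(K)\to I(K)\to\mathrm{Cl}(K)\to0$ and $0\to U_K\to K^\times\to P(K)\to0$. For every finite place $v$ of $F$ fix a place $w$ of $K$ above $v$, let $G_w=\mathrm{Gal}(K_w/F_v)$ be the Galois group of the completions, and let $U_{K_w}$ be the unit group of the ring of integers of $K_w$. Let $$\lambda:H^1(G,U_K)\to\bigoplus_{v\text{ finite}}H^1(G_w,U_{K_w})$$ be the localization map, whose component at $v$ is induced by the restriction homomorphism $G_w\to G$ and the inclusion $U_K\subseteq U_{K_w}$. Then $$\mathrm{Po}(K/F)=\mathrm{Cl}(K)^G_{\mathrm{trans}}\qquad\text{and}\qquad \mathrm{Ost}(K/F)\cong\mathrm{Coker}(\lambda).$$ -/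

import Mathlib

open NumberField IsDedekindDomain CategoryTheory
open scoped nonZeroDivisors DirectSum

noncomputable section

namespace Ostrowski

/-! ### Relative Polya group and Ostrowski quotient -/

section Polya

variable (F K : Type) [Field F] [NumberField F] [Field K] [NumberField K] [Algebra F K]

/-- A nonzero prime ideal of `𝓞 K`, as an element of the monoid of nonzero ideals. -/
def primeIdeal (P : HeightOneSpectrum (𝓞 K)) : (Ideal (𝓞 K))⁰ :=
  ⟨P.asIdeal, mem_nonZeroDivisors_of_ne_zero P.ne_bot⟩

/-- The relative Ostrowski ideal `Π_{𝔭^f}(K/F)`: the product of all the primes of `K` whose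
relative norm to `F` is `𝔭 ^ f`. It is the unit ideal when there is no such prime. -/
def relativeOstrowskiIdeal (p : HeightOneSpectrum (𝓞 F)) (f : ℕ) : (Ideal (𝓞 K))⁰ :=
  ∏ᶠ (P : HeightOneSpectrum (𝓞 K)) (_ : Ideal.relNorm (𝓞 F) P.asIdeal = p.asIdeal ^ f),
    primeIdeal K P

/-- The product which defines the relative Ostrowski ideal has finitely many factors. -/
theorem finite_primes_of_relNorm (p : HeightOneSpectrum (𝓞 F)) (f : ℕ) :
    {P : HeightOneSpectrum (𝓞 K) | Ideal.relNorm (𝓞 F) P.asIdeal = p.asIdeal ^ f}.Finite := by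
  have hne : (p.asIdeal ^ f).map (algebraMap (𝓞 F) (𝓞 K)) ≠ 0 := by
    rw [Ne, Ideal.zero_eq_bot,
      Ideal.map_eq_bot_iff_of_injective (FaithfulSMul.algebraMap_injective _ _)]
    exact pow_ne_zero _ p.ne_bot
  refine (Ideal.finite_factors hne).subset fun P hP => ?_
  have h := Ideal.relNorm_le_comap (R := 𝓞 F) P.asIdeal
  rw [Set.mem_ofPred_eq] at hP
  rw [hP, ← Ideal.map_le_iff_le_comap] at h
  exact Ideal.dvd_iff_le.mpr h

/-- The relative Polya group `Po(K/F)`: the subgroup of the class group of `K` generated by the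
classes of the relative Ostrowski ideals. -/
def relativePolyaGroup : Subgroup (ClassGroup (𝓞 K)) :=
  Subgroup.closure {c | ∃ (p : HeightOneSpectrum (𝓞 F)) (f : ℕ), 0 < f ∧
    c = ClassGroup.mk0 (relativeOstrowskiIdeal F K p f)}

/-- The capitulation map `ε_{K/F} : Cl(F) → Cl(K)`, induced by extension of ideals. -/
abbrev capitulationMap : ClassGroup (𝓞 F) →* ClassGroup (𝓞 K) :=
  ClassGroup.extendedHom (𝓞 F) (𝓞 K)

/-- The Ostrowski quotient `Ost(K/F) = Po(K/F) / (Po(K/F) ∩ ε_{K/F}(Cl(F)))`. -/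
abbrev OstrowskiQuotient : Type :=
  relativePolyaGroup F K ⧸ (capitulationMap F K).range.subgroupOf (relativePolyaGroup F K)

end Polya

/-! ### The Galois modules `U_K`, `I(K)`, `P(K)`, `Cl(K)` -/

section Global

variable (F K : Type) [Field F] [NumberField F] [Field K] [NumberField K] [Algebra F K]

/-- An action by ring automorphisms on `R` induces an action on the unit group of `R`. -/
@[reducible]
def unitsAction (G R : Type) [Group G] [CommRing R] [MulSemiringAction G R] :
    MulDistribMulAction G Rˣ where
  smul g u := Units.map (MulSemiringAction.toRingHom G R g).toMonoidHom u
  one_smul u := Units.ext (one_smul G (u : R))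
  mul_smul g h u := Units.ext (mul_smul g h (u : R))
  smul_mul g u v := Units.ext (smul_mul' g (u : R) (v : R))
  smul_one g := Units.ext (smul_one g)

/-- The Galois action on the unit group `U_K` of `𝓞 K`. -/
instance : MulDistribMulAction (K ≃ₐ[F] K) (𝓞 K)ˣ := unitsAction _ _

variable {F K} in
/-- The automorphism of the ring `𝓞 K` induced by a Galois automorphism. -/
def galRingEquiv (g : K ≃ₐ[F] K) : 𝓞 K ≃+* 𝓞 K := MulSemiringAction.toRingEquiv _ _ g

/-- The group `I(K)` of fractional ideals of `K`. -/
abbrev IdealGroup : Type := (FractionalIdeal (𝓞 K)⁰ K)ˣ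

/-- The group `P(K)` of principal fractional ideals of `K`. -/
abbrev PrincipalIdealGroup : Subgroup (IdealGroup K) := (toPrincipalIdeal (𝓞 K) K).range

/-- The Galois action on `I(K)`, by `I ↦ g(I)`. -/
instance : MulDistribMulAction (K ≃ₐ[F] K) (IdealGroup K) where
  smul g I := Units.mapEquiv
    (FractionalIdeal.ringEquivOfRingEquiv K K (galRingEquiv g)).toMulEquiv I
  one_smul I := by
    apply Units.ext
    change FractionalIdeal.ringEquivOfRingEquiv K K (galRingEquiv (1 : K ≃ₐ[F] K)) _ = _
    have : galRingEquiv (1 : K ≃ₐ[F] K) = RingEquiv.refl _ := rfl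
    rw [this, FractionalIdeal.ringEquivOfRingEquiv_refl]
    rfl
  mul_smul g h I := by
    apply Units.ext
    change FractionalIdeal.ringEquivOfRingEquiv K K (galRingEquiv (g * h)) _ =
      FractionalIdeal.ringEquivOfRingEquiv K K (galRingEquiv g)
        (FractionalIdeal.ringEquivOfRingEquiv K K (galRingEquiv h) _)
    have : galRingEquiv (g * h) = (galRingEquiv h).trans (galRingEquiv g) := rfl
    rw [this, FractionalIdeal.ringEquivOfRingEquiv_trans_apply K K K]
  smul_mul g I J := map_mul _ I J
  smul_one g := map_one _

variable {F K} in
theorem coe_smul_ideal (g : K ≃ₐ[F] K) (I : IdealGroup K) :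
    ((g • I : IdealGroup K) : FractionalIdeal (𝓞 K)⁰ K) =
      FractionalIdeal.ringEquivOfRingEquiv K K (galRingEquiv g) I := rfl

variable {F K} in
theorem ringEquivOfRingEquiv_eq (g : K ≃ₐ[F] K) (x : K) :
    IsFractionRing.ringEquivOfRingEquiv (K := K) (L := K) (galRingEquiv g) x = g x := by
  obtain ⟨a, b, hb, rfl⟩ := IsFractionRing.div_surjective (A := 𝓞 K) x
  rw [map_div₀, map_div₀, IsFractionRing.ringEquivOfRingEquiv_algebraMap,
    IsFractionRing.ringEquivOfRingEquiv_algebraMap]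
  rfl

variable {F K} in
/-- The fractional ideal `g • I` is the image of `I` under `g`. -/
theorem mem_smul_ideal (g : K ≃ₐ[F] K) (I : IdealGroup K) (x : K) :
    x ∈ ((g • I : IdealGroup K) : FractionalIdeal (𝓞 K)⁰ K) ↔
      ∃ y ∈ (I : FractionalIdeal (𝓞 K)⁰ K), g y = x := by
  rw [coe_smul_ideal, FractionalIdeal.ringEquivOfRingEquiv_apply]
  change (∃ y, y ∈ (I : FractionalIdeal (𝓞 K)⁰ K) ∧ _ = x) ↔ _
  refine exists_congr fun y => and_congr_right fun _ => ?_
  rw [← ringEquivOfRingEquiv_eq]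
  rfl

variable {F K} in
theorem smul_toPrincipalIdeal (g : K ≃ₐ[F] K) (x : Kˣ) :
    g • toPrincipalIdeal (𝓞 K) K x = toPrincipalIdeal (𝓞 K) K (g • x) := by
  apply Units.ext
  rw [coe_smul_ideal, coe_toPrincipalIdeal, coe_toPrincipalIdeal,
    FractionalIdeal.ringEquivOfRingEquiv_spanSingleton, ringEquivOfRingEquiv_eq]
  rfl

/-- The Galois action on `P(K)`, restricted from `I(K)`. -/
instance : MulDistribMulAction (K ≃ₐ[F] K) (PrincipalIdealGroup K) where
  smul g I := ⟨g • (I : IdealGroup K), by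
    obtain ⟨x, hx⟩ := I.2
    exact ⟨g • x, by rw [← smul_toPrincipalIdeal, hx]⟩⟩
  one_smul I := Subtype.ext (one_smul _ (I : IdealGroup K))
  mul_smul g h I := Subtype.ext (mul_smul g h (I : IdealGroup K))
  smul_mul g I J := Subtype.ext (smul_mul' g (I : IdealGroup K) (J : IdealGroup K))
  smul_one g := Subtype.ext (smul_one g)

theorem classGroup_mk_surjective :
    Function.Surjective (ClassGroup.mk K : IdealGroup K →* ClassGroup (𝓞 K)) := fun c => by
  obtain ⟨I, rfl⟩ := ClassGroup.mk0_surjective c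
  exact ⟨FractionalIdeal.mk0 K I, ClassGroup.mk_mk0 K I⟩

theorem classGroup_mk_eq_one_iff (I : IdealGroup K) :
    ClassGroup.mk K I = 1 ↔ I ∈ PrincipalIdealGroup K := by
  rw [ClassGroup.mk_eq_one_iff, mem_principal_ideals_iff]
  refine (Submodule.isPrincipal_iff _).trans (exists_congr fun x => ?_)
  rw [← FractionalIdeal.coeToSubmodule_inj, FractionalIdeal.coe_spanSingleton, eq_comm]

variable {F K} in
theorem classGroup_mk_smul_eq (g : K ≃ₐ[F] K) {I J : IdealGroup K}
    (h : ClassGroup.mk K I = ClassGroup.mk K J) :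
    ClassGroup.mk K (g • I) = ClassGroup.mk K (g • J) := by
  rw [← div_eq_one, ← map_div, classGroup_mk_eq_one_iff] at h ⊢
  obtain ⟨x, hx⟩ := h
  exact ⟨g • x, by rw [← smul_toPrincipalIdeal, hx, smul_div']⟩

/-- The Galois action on `Cl(K)`, by `[I] ↦ [g(I)]`. -/
instance : MulDistribMulAction (K ≃ₐ[F] K) (ClassGroup (𝓞 K)) where
  smul g c := ClassGroup.mk K (g • Function.surjInv (classGroup_mk_surjective K) c)
  one_smul c := by
    change ClassGroup.mk K ((1 : K ≃ₐ[F] K) • _) = c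
    rw [one_smul, Function.surjInv_eq (classGroup_mk_surjective K)]
  mul_smul g h c := by
    change ClassGroup.mk K ((g * h) • _) = ClassGroup.mk K (g • _)
    rw [mul_smul]
    exact classGroup_mk_smul_eq g (Function.surjInv_eq _ _).symm
  smul_mul g c d := by
    change ClassGroup.mk K (g • _) = ClassGroup.mk K (g • _) * ClassGroup.mk K (g • _)
    rw [← map_mul, ← smul_mul']
    exact classGroup_mk_smul_eq g (by simp only [map_mul, Function.surjInv_eq])
  smul_one g := by
    change ClassGroup.mk K (g • _) = 1
    rw [← map_one (ClassGroup.mk K)]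
    refine (classGroup_mk_smul_eq g (J := 1) ?_).trans (by rw [smul_one])
    rw [Function.surjInv_eq (classGroup_mk_surjective K), map_one]

variable {F K} in
theorem smul_classGroup_mk (g : K ≃ₐ[F] K) (I : IdealGroup K) :
    g • ClassGroup.mk K I = ClassGroup.mk K (g • I) :=
  classGroup_mk_smul_eq g (Function.surjInv_eq _ _)

/-! ### The transgression map -/

theorem shortExact_of_exact {k G : Type} [CommRing k] [Group G] (X : ShortComplex (Rep.{0} k G))
    (hinj : Function.Injective X.f.hom) (hsurj : Function.Surjective X.g.hom)
    (hex : ∀ x, X.g.hom x = 0 → ∃ y, X.f.hom y = x) : X.ShortExact where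
  exact := by
    rw [← ShortComplex.exact_map_iff_of_faithful _ (forget₂ (Rep.{0} k G) (ModuleCat.{0} k)),
      ShortComplex.moduleCat_exact_iff]
    exact hex
  mono_f := (Rep.mono_iff_injective _).2 hinj
  epi_g := (Rep.epi_iff_surjective _).2 hsurj

section General

variable {G M N P : Type} [Group G] [CommGroup M] [CommGroup N] [CommGroup P]
  [MulDistribMulAction G M] [MulDistribMulAction G N] [MulDistribMulAction G P]

/-- An equivariant homomorphism of multiplicative `G`-modules, as a morphism of
representations. -/
def repHom (f : M →* N) (hf : ∀ (g : G) (m : M), f (g • m) = g • f m) :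
    Rep.ofMulDistribMulAction G M ⟶ Rep.ofMulDistribMulAction G N :=
  Rep.ofHom
    { f.toAdditive.toIntLinearMap with
      isIntertwining' := fun g => LinearMap.ext fun m =>
        congrArg Additive.ofMul (hf g m.toMul) }

theorem repHom_apply (f : M →* N) (hf : ∀ (g : G) (m : M), f (g • m) = g • f m) (m : M) :
    (repHom f hf).hom (Additive.ofMul m) = Additive.ofMul (f m) := rfl

/-- A short exact sequence of multiplicative `G`-modules, as a short exact sequence of
representations. -/
theorem repHom_shortExact (f : M →* N) (hf : ∀ (g : G) (m : M), f (g • m) = g • f m)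
    (f' : N →* P) (hf' : ∀ (g : G) (n : N), f' (g • n) = g • f' n)
    (hinj : Function.Injective f) (hsurj : Function.Surjective f')
    (hex : f.range = f'.ker) (h0 : repHom f hf ≫ repHom f' hf' = 0) :
    (ShortComplex.mk (repHom f hf) (repHom f' hf') h0).ShortExact := by
  refine shortExact_of_exact _ hinj hsurj fun n hn => ?_
  obtain ⟨m, hm⟩ : Additive.toMul (n : Additive N) ∈ f.range := by
    rw [hex]
    exact hn
  exact ⟨Additive.ofMul m, hm⟩

theorem repHom_comp_eq_zero (f : M →* N) (hf : ∀ (g : G) (m : M), f (g • m) = g • f m)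
    (f' : N →* P) (hf' : ∀ (g : G) (n : N), f' (g • n) = g • f' n)
    (hex : f.range = f'.ker) : repHom f hf ≫ repHom f' hf' = 0 := by
  ext m
  exact (hex.le ⟨m.toMul, rfl⟩ : f m.toMul ∈ f'.ker)

end General

/-- The short complex of Galois modules `P(K) → I(K) → Cl(K)`. -/
def idealSequence : ShortComplex (Rep.{0} ℤ (K ≃ₐ[F] K)) where
  X₁ := Rep.ofMulDistribMulAction (K ≃ₐ[F] K) (PrincipalIdealGroup K)
  X₂ := Rep.ofMulDistribMulAction (K ≃ₐ[F] K) (IdealGroup K)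
  X₃ := Rep.ofMulDistribMulAction (K ≃ₐ[F] K) (ClassGroup (𝓞 K))
  f := repHom (PrincipalIdealGroup K).subtype fun _ _ => rfl
  g := repHom (ClassGroup.mk K) fun g I => (smul_classGroup_mk g I).symm
  zero := repHom_comp_eq_zero _ _ _ _ (by
    ext I; rw [Subgroup.range_subtype, MonoidHom.mem_ker, classGroup_mk_eq_one_iff])

theorem idealSequence_shortExact : (idealSequence F K).ShortExact :=
  repHom_shortExact _ _ _ _ (Subgroup.subtype_injective _) (classGroup_mk_surjective K) (by
    ext I; rw [Subgroup.range_subtype, MonoidHom.mem_ker, classGroup_mk_eq_one_iff]) _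

theorem unitSequence_range_eq_ker :
    (Units.map (algebraMap (𝓞 K) K).toMonoidHom : (𝓞 K)ˣ →* Kˣ).range =
      (toPrincipalIdeal (𝓞 K) K).rangeRestrict.ker := by
  ext x
  rw [MonoidHom.ker_rangeRestrict, MonoidHom.mem_ker, Units.ext_iff, coe_toPrincipalIdeal,
    Units.val_one, ← FractionalIdeal.spanSingleton_one,
    FractionalIdeal.spanSingleton_eq_spanSingleton]
  constructor
  · rintro ⟨u, rfl⟩
    refine ⟨u⁻¹, ?_⟩
    rw [Units.smul_def, Algebra.smul_def]
    exact (map_mul (algebraMap (𝓞 K) K) _ _).symm.trans (by simp)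
  · rintro ⟨u, hu⟩
    refine ⟨u⁻¹, Units.ext ?_⟩
    rw [Units.smul_def, Algebra.smul_def] at hu
    change algebraMap (𝓞 K) K (u⁻¹ : (𝓞 K)ˣ) = x
    rw [← mul_one (algebraMap (𝓞 K) K _), ← hu, ← mul_assoc, ← map_mul]
    simp

/-- The short complex of Galois modules `U_K → Kˣ → P(K)`. -/
def unitSequence : ShortComplex (Rep.{0} ℤ (K ≃ₐ[F] K)) where
  X₁ := Rep.ofMulDistribMulAction (K ≃ₐ[F] K) (𝓞 K)ˣ
  X₂ := Rep.ofMulDistribMulAction (K ≃ₐ[F] K) Kˣ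
  X₃ := Rep.ofMulDistribMulAction (K ≃ₐ[F] K) (PrincipalIdealGroup K)
  f := repHom (Units.map (algebraMap (𝓞 K) K).toMonoidHom) fun _ _ => rfl
  g := repHom (toPrincipalIdeal (𝓞 K) K).rangeRestrict fun g x =>
    Subtype.ext (smul_toPrincipalIdeal g x).symm
  zero := repHom_comp_eq_zero _ _ _ _ (unitSequence_range_eq_ker K)

theorem unitSequence_shortExact : (unitSequence F K).ShortExact :=
  repHom_shortExact _ _ _ _ (Units.map_injective (FaithfulSMul.algebraMap_injective _ _))
    (MonoidHom.rangeRestrict_surjective _) (unitSequence_range_eq_ker K) _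

/-- The transgression map `Cl(K)^G → H¹(G, P(K)) → H²(G, U_K)`, the composite of the connecting
homomorphisms of the two short exact sequences `0 → P(K) → I(K) → Cl(K) → 0` and
`0 → U_K → Kˣ → P(K) → 0`. -/
def transgression :
    ModuleCat.of ℤ (Rep.ofMulDistribMulAction (K ≃ₐ[F] K) (ClassGroup (𝓞 K))).ρ.invariants ⟶
      groupCohomology (Rep.ofMulDistribMulAction (K ≃ₐ[F] K) (𝓞 K)ˣ) 2 :=
  (groupCohomology.H0Iso (Rep.ofMulDistribMulAction (K ≃ₐ[F] K) (ClassGroup (𝓞 K)))).inv ≫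
    groupCohomology.δ (idealSequence_shortExact F K) 0 1 rfl ≫
    groupCohomology.δ (unitSequence_shortExact F K) 1 2 rfl

/-- The group `Cl(K)^G_trans` of transgressive ambiguous classes: the kernel of the transgression
map, as a subgroup of `Cl(K)`. -/
def transgressiveClasses : Subgroup (ClassGroup (𝓞 K)) :=
  AddSubgroup.toSubgroup' ((LinearMap.ker (transgression F K).hom).map
    (Submodule.subtype _)).toAddSubgroup

theorem mem_transgressiveClasses (c : ClassGroup (𝓞 K)) :
    c ∈ transgressiveClasses F K ↔
      ∃ h : ∀ g : K ≃ₐ[F] K, g • c = c, transgression F K ⟨Additive.ofMul c, h⟩ = 0 := by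
  constructor
  · rintro ⟨⟨d, hd⟩, h, rfl⟩
    exact ⟨hd, h⟩
  · rintro ⟨h, h'⟩
    exact ⟨⟨Additive.ofMul c, h⟩, h', rfl⟩

end Global

/-! ### Completions and the localization map -/

section Local

variable (F K : Type) [Field F] [NumberField F] [Field K] [NumberField K] [Algebra F K]
variable (v : HeightOneSpectrum (𝓞 F)) (w : HeightOneSpectrum (𝓞 K))
  [w.asIdeal.LiesOver v.asIdeal]

/-- The embedding of completions `F_v → K_w`, for `w` lying over `v`: the continuous extension of
the inclusion of `F` in `K`. -/
def completionMap : v.adicCompletion F →+* w.adicCompletion K :=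
  ((HeightOneSpectrum.adicCompletion.equiv K w).symm.toRingHom.comp
    (UniformSpace.Completion.mapRingHom
      (algebraMap (WithVal (v.valuation F)) (WithVal (w.valuation K)))
      (HeightOneSpectrum.uniformContinuous_algebraMap_liesOver F K v w).continuous)).comp
    (HeightOneSpectrum.adicCompletion.equiv F v).toRingHom

theorem continuous_completionMap : Continuous (completionMap F K v w) :=
  (HeightOneSpectrum.adicCompletion.continuous_ofCompletion K w).comp
    (UniformSpace.Completion.continuous_map.comp
      (HeightOneSpectrum.adicCompletion.continuous_toCompletion F v))

theorem completionMap_algebraMap (x : F) :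
    completionMap F K v w (algebraMap F _ x) = algebraMap K _ (algebraMap F K x) := by
  apply HeightOneSpectrum.adicCompletion.ext
  exact UniformSpace.Completion.map_coe
    (HeightOneSpectrum.uniformContinuous_algebraMap_liesOver F K v w) _

/-- `K_w` as an algebra over `F_v`. -/
@[reducible]
def completionAlgebra : Algebra (v.adicCompletion F) (w.adicCompletion K) :=
  (completionMap F K v w).toAlgebra

attribute [local instance] completionAlgebra

theorem completion_isScalarTower : IsScalarTower F (v.adicCompletion F) (w.adicCompletion K) :=
  .of_algebraMap_eq fun x => by
    rw [RingHom.algebraMap_toAlgebra, completionMap_algebraMap]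
    exact IsScalarTower.algebraMap_apply F K _ x

theorem completion_continuousSMul :
    ContinuousSMul (v.adicCompletion F) (w.adicCompletion K) where
  continuous_smul := ((continuous_completionMap F K v w).comp continuous_fst).mul continuous_snd

attribute [local instance] completion_isScalarTower completion_continuousSMul

/-- The local Galois group `G_w = Gal(K_w/F_v)`. -/
abbrev LocalGaloisGroup : Type := w.adicCompletion K ≃ₐ[v.adicCompletion F] w.adicCompletion K

variable {F K v w}

open scoped Valued in
theorem continuous_localGalois (σ : LocalGaloisGroup F K v w) : Continuous σ :=
  LinearMap.continuous_of_finiteDimensional σ.toLinearMap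

open scoped Valued in
/-- An element of `K_w` has valuation less than one if and only if its powers tend to zero. -/
theorem valued_lt_one_iff (x : w.adicCompletion K) :
    Valued.v x < 1 ↔ Filter.Tendsto (fun n : ℕ => x ^ n) Filter.atTop (nhds 0) := by
  rw [tendsto_pow_atTop_nhds_zero_iff_norm_lt_one]
  exact Valued.toNormedField.norm_lt_one_iff.symm

theorem valued_localGalois_lt_one (σ : LocalGaloisGroup F K v w) {x : w.adicCompletion K}
    (hx : Valued.v x < 1) : Valued.v (σ x) < 1 := by
  rw [valued_lt_one_iff] at hx ⊢
  have h := ((continuous_localGalois σ).tendsto 0).comp hx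
  simpa [Function.comp_def] using h

theorem localGalois_mem_integers (σ : LocalGaloisGroup F K v w) {x : w.adicCompletion K}
    (hx : x ∈ w.adicCompletionIntegers K) : σ x ∈ w.adicCompletionIntegers K := by
  rw [HeightOneSpectrum.mem_adicCompletionIntegers] at hx ⊢
  by_contra h
  rw [not_le] at h
  have h1 : Valued.v (σ x)⁻¹ < 1 := by
    rw [map_inv₀]
    exact inv_lt_one_of_one_lt₀ h
  have h2 := valued_localGalois_lt_one σ⁻¹ h1
  rw [map_inv₀] at h2
  have h3 : σ⁻¹ (σ x) = x := σ.symm_apply_apply x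
  rw [h3, map_inv₀] at h2
  have hx0 : x ≠ 0 := by
    rintro rfl
    simp at h
  have h4 : 0 < (Valued.v x : WithZero (Multiplicative ℤ)) :=
    zero_lt_iff.2 ((Valuation.ne_zero_iff _).2 hx0)
  exact absurd hx (not_le.2 ((inv_lt_one₀ h4).1 h2))

variable (F K v w)

/-- The action of `G_w` on the ring of integers of `K_w`, restricted from `K_w`. -/
instance : MulSemiringAction (LocalGaloisGroup F K v w) (w.adicCompletionIntegers K) where
  smul σ x := ⟨σ x, localGalois_mem_integers σ x.2⟩
  one_smul _ := rfl
  mul_smul _ _ _ := rfl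
  smul_zero σ := Subtype.ext (map_zero σ)
  smul_add σ x y := Subtype.ext (map_add σ (x : w.adicCompletion K) y)
  smul_one σ := Subtype.ext (map_one σ)
  smul_mul σ x y := Subtype.ext (map_mul σ (x : w.adicCompletion K) y)

/-- The group `U_{K_w}` of local units. -/
abbrev LocalUnits : Type := (w.adicCompletionIntegers K)ˣ

/-- The action of `G_w` on `U_{K_w}`. -/
instance : MulDistribMulAction (LocalGaloisGroup F K v w) (LocalUnits K w) := unitsAction _ _

instance : SMul (LocalGaloisGroup F K v w) (LocalUnits K w) :=
  MulDistribMulAction.toMulAction.toSMul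

variable [IsGalois F K]

/-- The restriction homomorphism `G_w → G`, `σ ↦ σ|_K`. -/
def restrictToGlobal : LocalGaloisGroup F K v w →* (K ≃ₐ[F] K) :=
  (AlgEquiv.restrictNormalHom K).comp (AlgEquiv.restrictScalarsHom F)

theorem algebraMap_restrictToGlobal (σ : LocalGaloisGroup F K v w) (x : K) :
    algebraMap K (w.adicCompletion K) (restrictToGlobal F K v w σ x) = σ (algebraMap K _ x) :=
  AlgEquiv.restrictNormal_commutes (σ.restrictScalars F) K x

/-- The inclusion `U_K → U_{K_w}`. -/
def unitsToLocal : (𝓞 K)ˣ →* LocalUnits K w :=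
  Units.map (algebraMap (𝓞 K) (w.adicCompletionIntegers K)).toMonoidHom

/-- The inclusion `U_K → U_{K_w}` as a morphism of `G_w`-modules. -/
def unitsToLocalRep :
    Rep.res (restrictToGlobal F K v w) (Rep.ofMulDistribMulAction (K ≃ₐ[F] K) (𝓞 K)ˣ) ⟶
      Rep.ofMulDistribMulAction (LocalGaloisGroup F K v w) (LocalUnits K w) :=
  Rep.ofHom
    { (unitsToLocal K w).toAdditive.toIntLinearMap with
      isIntertwining' := fun σ => LinearMap.ext fun m => congrArg Additive.ofMul <| by
        apply Units.ext
        apply Subtype.ext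
        exact algebraMap_restrictToGlobal F K v w σ _ }

/-- The cohomology group `H¹(G, U_K)`. -/
abbrev GlobalH1 : Type :=
  groupCohomology (Rep.ofMulDistribMulAction (K ≃ₐ[F] K) (𝓞 K)ˣ) 1

/-- The cohomology group `H¹(G_w, U_{K_w})`. -/
abbrev LocalH1 : Type :=
  groupCohomology (Rep.ofMulDistribMulAction (LocalGaloisGroup F K v w) (LocalUnits K w)) 1

/-- The localization map `H¹(G, U_K) → H¹(G_w, U_{K_w})` at one place, induced by the restriction
`G_w → G` and the inclusion `U_K → U_{K_w}`. -/
def localizationAt : GlobalH1 F K →+ LocalH1 F K v w :=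
  (groupCohomology.map (restrictToGlobal F K v w) (unitsToLocalRep F K v w) 1).hom.toAddMonoidHom

variable {F K v w}

/-- If the cocycle `z` is, in `Kˣ`, the coboundary of an element `a` with `w(a) = 1`, then its class
is trivial at `w`. -/
theorem localizationAt_eq_zero
    (z : groupCohomology.cocycles₁ (Rep.ofMulDistribMulAction (K ≃ₐ[F] K) (𝓞 K)ˣ)) (a : Kˣ)
    (ha : ∀ g : K ≃ₐ[F] K, g a / (a : K) = (((Additive.toMul (z g) : (𝓞 K)ˣ) : 𝓞 K) : K))
    (hw : w.valuation K (a : K) = 1) :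
    localizationAt F K v w (groupCohomology.H1π _ z) = 0 := by
  have hb : algebraMap K (w.adicCompletion K) a ≠ 0 := by simp
  have hv : Valued.v (algebraMap K (w.adicCompletion K) a) = 1 := by
    rw [← hw]
    exact HeightOneSpectrum.valuedAdicCompletion_eq_valuation' w (a : K)
  let u : LocalUnits K w :=
    { val := ⟨algebraMap K (w.adicCompletion K) a, by
        rw [HeightOneSpectrum.mem_adicCompletionIntegers, hv]⟩
      inv := ⟨(algebraMap K (w.adicCompletion K) a)⁻¹, by
        rw [HeightOneSpectrum.mem_adicCompletionIntegers, map_inv₀, hv, inv_one]⟩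
      val_inv := Subtype.ext (mul_inv_cancel₀ hb)
      inv_val := Subtype.ext (inv_mul_cancel₀ hb) }
  change groupCohomology.map (restrictToGlobal F K v w) (unitsToLocalRep F K v w) 1
    (groupCohomology.H1π _ z) = 0
  rw [groupCohomology.H1π_comp_map_apply, groupCohomology.H1π_eq_zero_iff]
  refine ⟨Additive.ofMul u, funext fun σ => ?_⟩
  change Additive.ofMul (σ • u / u) =
    Additive.ofMul (unitsToLocal K w (Additive.toMul (z (restrictToGlobal F K v w σ))))
  congr 1
  rw [div_eq_iff_eq_mul]
  apply Units.ext
  apply Subtype.ext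
  change σ (algebraMap K (w.adicCompletion K) a) =
    algebraMap K (w.adicCompletion K) _ * algebraMap K (w.adicCompletion K) a
  rw [← algebraMap_restrictToGlobal, ← map_mul]
  congr 1
  rw [← div_eq_iff a.ne_zero]
  exact ha _

end Local

/-! ### The localization map into the direct sum -/

section Localization

variable (F K : Type) [Field F] [NumberField F] [Field K] [NumberField K] [Algebra F K]
  [IsGalois F K] (w : HeightOneSpectrum (𝓞 F) → HeightOneSpectrum (𝓞 K))
  [∀ v, (w v).asIdeal.LiesOver v.asIdeal]

/-- A class in `H¹(G, U_K)` is locally trivial at almost all finite places. -/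
theorem finite_localizationAt_ne_zero (c : GlobalH1 F K) :
    {v : HeightOneSpectrum (𝓞 F) | localizationAt F K v (w v) c ≠ 0}.Finite := by
  induction c using groupCohomology.H1_induction_on with | h z => ?_
  obtain ⟨a, ha⟩ :=
    groupCohomology.isMulCoboundary₁_of_isMulCocycle₁_of_aut_to_units (K := F) (L := K)
      (fun g => Units.map (algebraMap (𝓞 K) K).toMonoidHom (Additive.toMul (z g)))
      (fun g h => by
        have hz := groupCohomology.isMulCocycle₁_of_mem_cocycles₁ _ z.2 g h
        exact (congrArg (Units.map (algebraMap (𝓞 K) K).toMonoidHom) hz).trans (map_mul _ _ _))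
  have hinj : Function.Injective w := fun v₁ v₂ h => by
    have h₁ := Ideal.LiesOver.over (P := (w v₁).asIdeal) (p := v₁.asIdeal)
    have h₂ := Ideal.LiesOver.over (P := (w v₂).asIdeal) (p := v₂.asIdeal)
    exact HeightOneSpectrum.ext (by rw [h₁, h₂, h])
  refine (((HeightOneSpectrum.Support.finite (𝓞 K) (a : K)).union
    (HeightOneSpectrum.Support.finite (𝓞 K) (a : K)⁻¹)).preimage hinj.injOn).subset fun v hv => ?_
  by_contra h
  simp only [HeightOneSpectrum.Support, Set.mem_preimage, Set.mem_union, Set.mem_ofPred_eq,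
    not_or, not_lt, map_inv₀] at h
  refine hv (localizationAt_eq_zero z a (fun g => ?_) (le_antisymm h.1 ?_))
  · exact (Units.val_div_eq_div_val _ _).symm.trans (congrArg (Units.val (α := K)) (ha g))
  · have h0 : 0 < (w v).valuation K (a : K) :=
      zero_lt_iff.2 ((Valuation.ne_zero_iff _).2 a.ne_zero)
    exact (inv_le_one₀ h0).1 h.2

open Classical in
theorem mk_localizationAt_apply (c : GlobalH1 F K) (v : HeightOneSpectrum (𝓞 F)) :
    DirectSum.mk (fun v => LocalH1 F K v (w v)) (finite_localizationAt_ne_zero F K w c).toFinset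
      (fun v => localizationAt F K v (w v) c) v = localizationAt F K v (w v) c := by
  by_cases h : v ∈ (finite_localizationAt_ne_zero F K w c).toFinset
  · rw [DirectSum.mk_apply_of_mem h]
  · rw [DirectSum.mk_apply_of_notMem h]
    simpa [eq_comm] using h

open Classical in
/-- The localization map `λ : H¹(G, U_K) → ⨁_v H¹(G_w, U_{K_w})`, where `v` runs over the finite
places of `F` and `w = w v` is a fixed place of `K` over `v`. -/
def localizationMap :
    GlobalH1 F K →+ ⨁ v : HeightOneSpectrum (𝓞 F), LocalH1 F K v (w v) :=
  AddMonoidHom.mk'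
    (fun c => DirectSum.mk (fun v => LocalH1 F K v (w v))
      (finite_localizationAt_ne_zero F K w c).toFinset fun v => localizationAt F K v (w v) c)
    fun c d => by
      ext v : 1
      rw [DirectSum.add_apply]
      simp only [mk_localizationAt_apply]
      exact map_add _ _ _

theorem localizationMap_apply (c : GlobalH1 F K) (v : HeightOneSpectrum (𝓞 F)) :
    localizationMap F K w c v = localizationAt F K v (w v) c :=
  mk_localizationAt_apply F K w c v

/-- The cokernel of the localization map. -/
abbrev LocalizationCokernel : Type :=
  (⨁ v : HeightOneSpectrum (𝓞 F), LocalH1 F K v (w v)) ⧸ (localizationMap F K w).range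

end Localization

end Ostrowski

end

/-! Let `D` be the free abelian group on the nonzero primes `v` of `F`. Since `G` permutes the
primes above each `v` transitively, sending `v` to the product of the primes above it (`orbitHom`)
maps `D` onto the invariant ideals `I(K)^G`.

First equality. In a Galois extension the primes above `v` share one residue degree, so an Ostrowski
ideal is either such a product or the unit ideal. Hence `Po(K/F)` is the image of `I(K)^G` in
`Cl(K)`. By Hilbert 90 for `Kˣ`, the map `H¹(G, P(K)) → H²(G, U_K)` is injective, so the
transgressive classes form the kernel of `Cl(K)^G → H¹(G, P(K))`, which is again the image of
`I(K)^G`.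

Isomorphism. Both groups are quotients of `D`, and their kernels agree. Let `e_v` be the common
ramification index above `v`. A prime `v` extends to the `e_v`-th power of its product, so
`ε(Cl(F))` is the image of the vectors with `e_v ∣ d v` (`mem_range_capitulationMap_iff`). Thus
`Ost(K/F)` is `D` modulo these vectors and those giving a principal ideal. On the local side,
Hilbert 90 shows that `H¹(G_w, U_{K_w})` is cyclic of order `e_v`, generated by the class of `σ ↦
σ(π)/π` for a uniformizer `π` (`zsmul_localGenerator_eq_zero_iff`). A global class has the form `g ↦
g(a)/a` with `(a)` invariant, and its component at `v` is the multiplicity of `w` in `(a)` times the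
generator (`localizationAt_H1π`). The image of `λ` therefore comes from exactly the principal
vectors. -/

noncomputable section

namespace Ostrowski

set_option linter.unusedSectionVars false

/-! ### Multiplicities of fractional ideals -/

section Count

variable {K : Type} [Field K] [NumberField K]

/-- The multiplicity of a prime in a fractional ideal, as a homomorphism. -/
def countHom (P : HeightOneSpectrum (𝓞 K)) : Additive (IdealGroup K) →+ ℤ :=
  AddMonoidHom.mk' (fun I => FractionalIdeal.count K P (Additive.toMul I : IdealGroup K))
    fun I J => by
      rw [toMul_add, Units.val_mul, FractionalIdeal.count_mul K P (Units.ne_zero _)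
        (Units.ne_zero _)]

theorem countHom_apply (P : HeightOneSpectrum (𝓞 K)) (I : IdealGroup K) :
    countHom P (Additive.ofMul I) = FractionalIdeal.count K P I := rfl

/-- A fractional ideal is determined by its multiplicities. -/
theorem idealGroup_ext {I J : IdealGroup K}
    (h : ∀ P, FractionalIdeal.count K P (I : FractionalIdeal (𝓞 K)⁰ K) =
      FractionalIdeal.count K P (J : FractionalIdeal (𝓞 K)⁰ K)) : I = J := by
  apply Units.ext
  rw [← FractionalIdeal.finprod_heightOneSpectrum_factorization' K I.ne_zero,
    ← FractionalIdeal.finprod_heightOneSpectrum_factorization' K J.ne_zero]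
  simp only [h]

/-- Writing `a` as a quotient of two integers reduces this to integral elements, where both sides
count the same prime factor. It later turns local valuations into exponents of ideals. -/
theorem valuation_eq_exp_neg_count (P : HeightOneSpectrum (𝓞 K)) (a : Kˣ) :
    P.valuation K (a : K) =
      WithZero.exp (-FractionalIdeal.count K P (toPrincipalIdeal (𝓞 K) K a : IdealGroup K)) := by
  have key (x : 𝓞 K) (hx : x ≠ 0) : P.valuation K (algebraMap (𝓞 K) K x) =
      WithZero.exp (-FractionalIdeal.count K P
        (FractionalIdeal.spanSingleton (𝓞 K)⁰ (algebraMap (𝓞 K) K x))) := by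
    rw [HeightOneSpectrum.valuation_of_algebraMap, P.intValuation_if_neg hx,
      ← FractionalIdeal.coeIdeal_span_singleton, FractionalIdeal.count_coe]
    simpa using hx
  obtain ⟨x, y, hy, ha⟩ := IsFractionRing.div_surjective (A := 𝓞 K) (a : K)
  have hy : y ≠ 0 := nonZeroDivisors.ne_zero hy
  have hx : x ≠ 0 := by
    rintro rfl
    rw [map_zero, zero_div] at ha
    exact a.ne_zero ha.symm
  rw [coe_toPrincipalIdeal, ← ha, map_div₀, key x hx, key y hy, ← WithZero.exp_sub, div_eq_mul_inv,
    ← FractionalIdeal.spanSingleton_mul_spanSingleton, ← FractionalIdeal.spanSingleton_inv,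
    FractionalIdeal.count_mul, FractionalIdeal.count_inv]
  · congr 1
    ring
  · exact FractionalIdeal.spanSingleton_ne_zero_iff.2 (by simpa using hx)
  · rw [FractionalIdeal.spanSingleton_inv, FractionalIdeal.spanSingleton_ne_zero_iff]
    simpa using hy

end Count

/-! ### Invariant ideals -/

section Invariant

variable (F K : Type) [Field F] [NumberField F] [Field K] [NumberField K] [Algebra F K]

/-- The permutation of the primes of `K` induced by a Galois automorphism. -/
def primePerm (g : K ≃ₐ[F] K) : HeightOneSpectrum (𝓞 K) ≃ HeightOneSpectrum (𝓞 K) :=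
  HeightOneSpectrum.equivOfRingEquiv (galRingEquiv g)

variable {F K}

theorem ringEquivOfRingEquiv_prime (g : K ≃ₐ[F] K) (P : HeightOneSpectrum (𝓞 K)) :
    FractionalIdeal.ringEquivOfRingEquiv K K (galRingEquiv g) (P.asIdeal : FractionalIdeal (𝓞 K)⁰ K) =
      ((primePerm F K g P).asIdeal : FractionalIdeal (𝓞 K)⁰ K) := by
  ext x
  rw [FractionalIdeal.ringEquivOfRingEquiv_apply]
  change (∃ y, y ∈ (P.asIdeal : FractionalIdeal (𝓞 K)⁰ K) ∧
    IsFractionRing.ringEquivOfRingEquiv (K := K) (L := K) (galRingEquiv g) y = x) ↔ _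
  simp only [ringEquivOfRingEquiv_eq, FractionalIdeal.mem_coeIdeal]
  constructor
  · rintro ⟨_, ⟨y, hy, rfl⟩, rfl⟩
    refine ⟨galRingEquiv g y, ?_, rfl⟩
    -- `primePerm` is pullback along the inverse automorphism, so membership in the image prime is
    -- tested on the preimage.
    change (galRingEquiv g).symm (galRingEquiv g y) ∈ P.asIdeal
    rwa [RingEquiv.symm_apply_apply]
  · rintro ⟨y, hy, rfl⟩
    refine ⟨_, ⟨(galRingEquiv g).symm y, hy, rfl⟩, ?_⟩
    exact congrArg (algebraMap (𝓞 K) K) ((galRingEquiv g).apply_symm_apply y)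

/-- Apply `g` to the prime factorization of `I` and reindex the product by the permutation of the
primes. -/
theorem count_smul (g : K ≃ₐ[F] K) (I : IdealGroup K) (P : HeightOneSpectrum (𝓞 K)) :
    FractionalIdeal.count K (primePerm F K g P) (g • I : IdealGroup K) =
      FractionalIdeal.count K P (I : FractionalIdeal (𝓞 K)⁰ K) := by
  have hfin := FractionalIdeal.finite_factors (I : FractionalIdeal (𝓞 K)⁰ K)
  have hsupp : Function.HasFiniteMulSupport fun Q : HeightOneSpectrum (𝓞 K) =>
      (Q.asIdeal : FractionalIdeal (𝓞 K)⁰ K) ^ FractionalIdeal.count K Q I := by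
    refine (Filter.eventually_cofinite.1 hfin).subset fun Q hQ h => hQ ?_
    simp only [h, zpow_zero]
  rw [coe_smul_ideal]
  conv_lhs => rw [← FractionalIdeal.finprod_heightOneSpectrum_factorization' K I.ne_zero]
  have h1 := MonoidHom.map_finprod
    ((FractionalIdeal.ringEquivOfRingEquiv K K (galRingEquiv g) :
      FractionalIdeal (𝓞 K)⁰ K →* FractionalIdeal (𝓞 K)⁰ K)) hsupp
  have h2 : FractionalIdeal.ringEquivOfRingEquiv K K (galRingEquiv g)
      (∏ᶠ Q : HeightOneSpectrum (𝓞 K),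
        (Q.asIdeal : FractionalIdeal (𝓞 K)⁰ K) ^ FractionalIdeal.count K Q I) =
      ∏ᶠ Q : HeightOneSpectrum (𝓞 K), (Q.asIdeal : FractionalIdeal (𝓞 K)⁰ K) ^
        FractionalIdeal.count K ((primePerm F K g).symm Q) I := by
    refine h1.trans ?_
    refine Eq.trans (finprod_congr fun Q => ?_) (finprod_comp_equiv (primePerm F K g))
    rw [Equiv.symm_apply_apply, ← ringEquivOfRingEquiv_prime]
    exact map_zpow₀ (FractionalIdeal.ringEquivOfRingEquiv K K (galRingEquiv g)) _ _
  rw [h2, FractionalIdeal.count_finprod, Equiv.symm_apply_apply]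
  exact (primePerm F K g).symm.injective.tendsto_cofinite.eventually hfin

theorem under_primePerm (g : K ≃ₐ[F] K) (P : HeightOneSpectrum (𝓞 K)) :
    (primePerm F K g P).under (𝓞 F) = P.under (𝓞 F) := by
  ext x
  change (galRingEquiv g).symm (algebraMap (𝓞 F) (𝓞 K) x) ∈ P.asIdeal ↔
    algebraMap (𝓞 F) (𝓞 K) x ∈ P.asIdeal
  have : (galRingEquiv g).symm (algebraMap (𝓞 F) (𝓞 K) x) = algebraMap (𝓞 F) (𝓞 K) x := by
    rw [RingEquiv.symm_apply_eq]
    exact RingOfIntegers.ext (g.commutes (x : F)).symm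
  rw [this]

/-- Transitivity of the Galois action; together with `under_primePerm` it identifies the orbits of
primes with the fibres of `under`. -/
theorem exists_primePerm_eq [IsGalois F K] {P Q : HeightOneSpectrum (𝓞 K)}
    (h : P.under (𝓞 F) = Q.under (𝓞 F)) : ∃ g, primePerm F K g P = Q := by
  have hPQ : P.asIdeal.under (𝓞 F) = Q.asIdeal.under (𝓞 F) := congrArg (·.asIdeal) h
  have : IsGaloisGroup (K ≃ₐ[F] K) (𝓞 F) (𝓞 K) := IsGaloisGroup.of_isFractionRing _ _ _ F K
  obtain ⟨g, hg⟩ := Algebra.IsInvariant.exists_smul_of_under_eq (𝓞 F) (𝓞 K) (K ≃ₐ[F] K) _ _ hPQ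
  refine ⟨g, HeightOneSpectrum.ext ?_⟩
  rw [hg]
  ext x
  rw [Ideal.mem_pointwise_smul_iff_inv_smul_mem]
  rfl

/-- A fractional ideal is Galois invariant if and only if conjugate primes have the same
multiplicity in it. -/
theorem smul_ideal_eq_iff [IsGalois F K] (I : IdealGroup K) :
    (∀ g : K ≃ₐ[F] K, g • I = I) ↔ ∀ P Q : HeightOneSpectrum (𝓞 K),
      P.under (𝓞 F) = Q.under (𝓞 F) →
        FractionalIdeal.count K P (I : FractionalIdeal (𝓞 K)⁰ K) =
          FractionalIdeal.count K Q (I : FractionalIdeal (𝓞 K)⁰ K) := by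
  constructor
  · intro h P Q hPQ
    obtain ⟨g, rfl⟩ := exists_primePerm_eq hPQ
    rw [← count_smul g I P, h g]
  · intro h g
    refine idealGroup_ext fun P => ?_
    obtain ⟨Q, rfl⟩ := (primePerm F K g).surjective P
    rw [count_smul]
    exact h _ _ (under_primePerm g Q).symm

variable (F K)

theorem finite_under_eq (v : HeightOneSpectrum (𝓞 F)) :
    {P : HeightOneSpectrum (𝓞 K) | P.under (𝓞 F) = v}.Finite := by
  have := v.isMaximal
  refine Set.Finite.of_finite_image (f := HeightOneSpectrum.asIdeal)
    ((IsDedekindDomain.primesOver_finite v.asIdeal (𝓞 K)).subset ?_)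
    fun _ _ _ _ h => HeightOneSpectrum.ext h
  rintro _ ⟨P, rfl, rfl⟩
  exact ⟨P.isPrime, ⟨rfl⟩⟩

/-- The product of all the primes of `K` over `v`. -/
def orbitIdeal (v : HeightOneSpectrum (𝓞 F)) : (Ideal (𝓞 K))⁰ :=
  ∏ P ∈ (finite_under_eq F K v).toFinset, primeIdeal K P

open Classical in
theorem count_orbitIdeal (v : HeightOneSpectrum (𝓞 F)) (P : HeightOneSpectrum (𝓞 K)) :
    FractionalIdeal.count K P (FractionalIdeal.mk0 K (orbitIdeal F K v) : IdealGroup K) =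
      if P.under (𝓞 F) = v then 1 else 0 := by
  rw [orbitIdeal, map_prod, Units.coe_prod, FractionalIdeal.count_prod]
  · simp only [FractionalIdeal.coe_mk0, primeIdeal, FractionalIdeal.count_maximal]
    rw [Finset.sum_ite_eq']
    simp
  · exact fun _ _ => Units.ne_zero _

/-- The homomorphism which sends the basis vector at `v` to the product of the primes over
`v`. -/
def orbitHom : (HeightOneSpectrum (𝓞 F) →₀ ℤ) →+ Additive (IdealGroup K) :=
  Finsupp.liftAddHom fun v =>
    zmultiplesHom _ (Additive.ofMul (FractionalIdeal.mk0 K (orbitIdeal F K v)))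

theorem orbitHom_single (v : HeightOneSpectrum (𝓞 F)) (n : ℤ) :
    orbitHom F K (Finsupp.single v n) =
      n • Additive.ofMul (FractionalIdeal.mk0 K (orbitIdeal F K v)) := by
  rw [orbitHom, Finsupp.liftAddHom_apply_single, zmultiplesHom_apply]

/-- Both sides are additive in `d`, so basis vectors suffice. The vector `d` can thus be read off
from the ideal. -/
theorem countHom_orbitHom (P : HeightOneSpectrum (𝓞 K)) (d : HeightOneSpectrum (𝓞 F) →₀ ℤ) :
    countHom P (orbitHom F K d) = d (P.under (𝓞 F)) := by
  suffices (countHom P).comp (orbitHom F K) = Finsupp.applyAddHom (P.under (𝓞 F)) from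
    DFunLike.congr_fun this d
  ext v : 2
  classical
  simp only [AddMonoidHom.comp_apply, Finsupp.singleAddHom_apply, Finsupp.applyAddHom_apply]
  rw [orbitHom_single, one_smul, countHom_apply, count_orbitIdeal, Finsupp.single_apply]
  simp only [eq_comm]

theorem under_surjective : Function.Surjective
    (HeightOneSpectrum.under (𝓞 F) : HeightOneSpectrum (𝓞 K) → HeightOneSpectrum (𝓞 F)) := by
  intro v
  have := v.isMaximal
  obtain ⟨P, hP, hPv⟩ := Ideal.exists_maximal_ideal_liesOver_of_isIntegral (S := 𝓞 K) v.asIdeal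
  refine ⟨⟨P, hP.isPrime, Ideal.ne_bot_of_liesOver_of_ne_bot v.ne_bot P⟩, HeightOneSpectrum.ext ?_⟩
  exact hPv.over.symm

/-- The ideals in the image of `orbitHom` are the Galois invariant fractional ideals. -/
theorem exists_orbitHom_eq_iff [IsGalois F K] (I : IdealGroup K) :
    (∃ d, orbitHom F K d = Additive.ofMul I) ↔ ∀ g : K ≃ₐ[F] K, g • I = I := by
  rw [smul_ideal_eq_iff]
  constructor
  · rintro ⟨d, hd⟩ P Q hPQ
    rw [← countHom_apply, ← countHom_apply, ← hd, countHom_orbitHom, countHom_orbitHom, hPQ]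
  · intro h
    -- One prime is chosen above each `v` to read off the exponent; invariance makes the choice
    -- irrelevant. Since `s` is injective, only finitely many exponents are nonzero.
    let s := Function.surjInv (under_surjective F K)
    have hs (v) : (s v).under (𝓞 F) = v := Function.surjInv_eq (under_surjective F K) v
    have hsi : Function.Injective s := Function.injective_surjInv (under_surjective F K)
    refine ⟨Finsupp.ofSupportFinite
      (fun v => FractionalIdeal.count K (s v) (I : FractionalIdeal (𝓞 K)⁰ K))
      (hsi.tendsto_cofinite.eventually
        (FractionalIdeal.finite_factors (I : FractionalIdeal (𝓞 K)⁰ K))), ?_⟩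
    refine Additive.toMul.injective (idealGroup_ext fun P => ?_)
    refine (countHom_orbitHom F K P _).trans ?_
    exact h _ _ (hs _)

end Invariant

/-! ### Generators of the relative Polya group and of the capitulated classes -/

section Generators

variable (F K : Type) [Field F] [NumberField F] [Field K] [NumberField K] [Algebra F K]

/-- The norm of `P` is the prime below it raised to the residue degree, and a nonzero prime power
determines its base and its exponent. -/
theorem relNorm_eq_pow_iff (P : HeightOneSpectrum (𝓞 K)) (v : HeightOneSpectrum (𝓞 F)) {f : ℕ}
    (hf : 0 < f) : Ideal.relNorm (𝓞 F) P.asIdeal = v.asIdeal ^ f ↔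
      P.under (𝓞 F) = v ∧ P.asIdeal.inertiaDeg (𝓞 F) = f := by
  have hmax := P.isMaximal
  have hpow : Ideal.relNorm (𝓞 F) P.asIdeal =
      (P.under (𝓞 F)).asIdeal ^ P.asIdeal.inertiaDeg (𝓞 F) := by
    have := (P.under (𝓞 F)).isMaximal
    have : P.asIdeal.LiesOver (P.under (𝓞 F)).asIdeal := ⟨rfl⟩
    exact Ideal.relNorm_eq_pow_of_isMaximal _ _
  constructor
  · intro h
    have hle : v.asIdeal ≤ (P.under (𝓞 F)).asIdeal := by
      have h1 := Ideal.relNorm_le_comap (R := 𝓞 F) P.asIdeal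
      rw [h] at h1
      exact (P.under (𝓞 F)).isPrime.le_of_pow_le h1
    have hv : P.under (𝓞 F) = v :=
      (HeightOneSpectrum.ext (v.isMaximal.eq_of_le (P.under (𝓞 F)).isPrime.ne_top hle)).symm
    refine ⟨hv, ?_⟩
    rw [hpow, hv] at h
    exact pow_injective_of_not_isUnit (mt Ideal.isUnit_iff.1 v.isPrime.ne_top) v.ne_bot h
  · rintro ⟨rfl, rfl⟩
    exact hpow

theorem inertiaDeg_eq_of_under_eq [IsGalois F K] {P Q : HeightOneSpectrum (𝓞 K)}
    (h : P.under (𝓞 F) = Q.under (𝓞 F)) :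
    P.asIdeal.inertiaDeg (𝓞 F) = Q.asIdeal.inertiaDeg (𝓞 F) := by
  have : IsGaloisGroup (K ≃ₐ[F] K) (𝓞 F) (𝓞 K) := IsGaloisGroup.of_isFractionRing _ _ _ F K
  have : P.asIdeal.LiesOver (P.under (𝓞 F)).asIdeal := ⟨rfl⟩
  have : Q.asIdeal.LiesOver (P.under (𝓞 F)).asIdeal := ⟨by rw [h]; rfl⟩
  exact Ideal.inertiaDeg_eq_of_isGaloisGroup (P.under (𝓞 F)).asIdeal _ _ (K ≃ₐ[F] K)

/-- All primes of a fibre have the same residue degree, so at this exponent the norm condition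
selects the whole fibre; at any other positive exponent it selects nothing. -/
theorem relativeOstrowskiIdeal_of_eq [IsGalois F K] (P : HeightOneSpectrum (𝓞 K)) :
    relativeOstrowskiIdeal F K (P.under (𝓞 F)) (P.asIdeal.inertiaDeg (𝓞 F)) =
      orbitIdeal F K (P.under (𝓞 F)) := by
  have := P.isMaximal
  rw [orbitIdeal, ← finprod_mem_eq_finite_toFinset_prod]
  refine finprod_mem_congr (Set.ext fun Q => ?_) fun _ _ => rfl
  change Ideal.relNorm (𝓞 F) Q.asIdeal = _ ↔ Q.under (𝓞 F) = _
  rw [relNorm_eq_pow_iff F K _ _ (Ideal.inertiaDeg_pos _ _)]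
  exact and_iff_left_of_imp fun h => inertiaDeg_eq_of_under_eq F K h

theorem relativeOstrowskiIdeal_of_ne [IsGalois F K] (P : HeightOneSpectrum (𝓞 K)) {f : ℕ}
    (hf : 0 < f) (hP : P.asIdeal.inertiaDeg (𝓞 F) ≠ f) :
    relativeOstrowskiIdeal F K (P.under (𝓞 F)) f = 1 := by
  rw [relativeOstrowskiIdeal, ← finprod_mem_empty (f := primeIdeal K)]
  refine finprod_mem_congr (Set.eq_empty_iff_forall_notMem.2 fun Q hQ => hP ?_) fun _ _ => rfl
  have h := (relNorm_eq_pow_iff F K _ _ hf).1 hQ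
  rw [← h.2]
  exact inertiaDeg_eq_of_under_eq F K h.1.symm

/-- The class of the ideal `orbitHom d`. -/
def orbitClass : (HeightOneSpectrum (𝓞 F) →₀ ℤ) →+ Additive (ClassGroup (𝓞 K)) :=
  (ClassGroup.mk K : IdealGroup K →* ClassGroup (𝓞 K)).toAdditive.comp (orbitHom F K)

theorem orbitClass_single (v : HeightOneSpectrum (𝓞 F)) (n : ℤ) :
    orbitClass F K (Finsupp.single v n) =
      n • Additive.ofMul (ClassGroup.mk0 (orbitIdeal F K v)) := by
  rw [orbitClass, AddMonoidHom.comp_apply, orbitHom_single, map_zsmul]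
  congr 1
  exact congrArg Additive.ofMul (ClassGroup.mk_mk0 K _)

theorem orbitClass_apply (d : HeightOneSpectrum (𝓞 F) →₀ ℤ) :
    orbitClass F K d =
      ∑ v ∈ d.support, d v • Additive.ofMul (ClassGroup.mk0 (orbitIdeal F K v)) := by
  conv_lhs => rw [← d.sum_single]
  rw [Finsupp.sum, map_sum]
  exact Finset.sum_congr rfl fun v _ => orbitClass_single F K v _

theorem mem_relativePolyaGroup_iff [IsGalois F K] (c : ClassGroup (𝓞 K)) :
    c ∈ relativePolyaGroup F K ↔ ∃ d, orbitClass F K d = Additive.ofMul c := by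
  suffices h : (relativePolyaGroup F K).toAddSubgroup = (orbitClass F K).range from
    (SetLike.ext_iff.1 h (Additive.ofMul c))
  apply le_antisymm
  · change relativePolyaGroup F K ≤ AddSubgroup.toSubgroup' (orbitClass F K).range
    refine (Subgroup.closure_le _).2 ?_
    rintro _ ⟨v, f, hf, rfl⟩
    -- Any prime above `v` serves to name the residue degree common to the fibre.
    obtain ⟨P, rfl⟩ := under_surjective F K v
    by_cases h : P.asIdeal.inertiaDeg (𝓞 F) = f
    · rw [← h, relativeOstrowskiIdeal_of_eq]
      exact ⟨Finsupp.single _ 1, by rw [orbitClass_single, one_smul]; rfl⟩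
    · rw [relativeOstrowskiIdeal_of_ne F K P hf h, map_one]
      exact one_mem _
  · rintro _ ⟨d, rfl⟩
    rw [orbitClass_apply]
    refine sum_mem fun v _ => zsmul_mem (S := AddSubgroup (Additive (ClassGroup (𝓞 K)))) ?_ _
    change ClassGroup.mk0 (orbitIdeal F K v) ∈ relativePolyaGroup F K
    refine Subgroup.subset_closure ?_
    obtain ⟨P, rfl⟩ := under_surjective F K v
    have := P.isMaximal
    refine ⟨P.under (𝓞 F), P.asIdeal.inertiaDeg (𝓞 F), Ideal.inertiaDeg_pos _ _, ?_⟩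
    rw [relativeOstrowskiIdeal_of_eq]

/-- The relative Polya group consists of the classes of the Galois invariant ideals. -/
theorem mem_relativePolyaGroup_iff_exists_invariant [IsGalois F K] (c : ClassGroup (𝓞 K)) :
    c ∈ relativePolyaGroup F K ↔
      ∃ I : IdealGroup K, (∀ g : K ≃ₐ[F] K, g • I = I) ∧ ClassGroup.mk K I = c := by
  rw [mem_relativePolyaGroup_iff]
  constructor
  · rintro ⟨d, hd⟩
    exact ⟨_, (exists_orbitHom_eq_iff F K (Additive.toMul (orbitHom F K d))).1 ⟨d, rfl⟩, hd⟩
  · rintro ⟨I, hI, rfl⟩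
    obtain ⟨d, hd⟩ := (exists_orbitHom_eq_iff F K I).2 hI
    exact ⟨d, congrArg (ClassGroup.mk K : IdealGroup K →* ClassGroup (𝓞 K)).toAdditive hd⟩

theorem orbitClass_eq_zero_iff (d : HeightOneSpectrum (𝓞 F) →₀ ℤ) :
    orbitClass F K d = 0 ↔
      ∃ a : Kˣ, orbitHom F K d = Additive.ofMul (toPrincipalIdeal (𝓞 K) K a) := by
  refine (classGroup_mk_eq_one_iff K (Additive.toMul (orbitHom F K d))).trans ?_
  exact exists_congr fun a => eq_comm

/-- In a Galois extension the ramification index is constant on the fibre, so it factors out of the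
decomposition of the extended prime. -/
theorem extendedIdeal_prime [IsGalois F K] (v : HeightOneSpectrum (𝓞 F)) :
    ClassGroup.extendedIdeal (𝓞 F) (𝓞 K) (primeIdeal F v) =
      orbitIdeal F K v ^ v.asIdeal.ramificationIdxIn (𝓞 K) := by
  have : IsGaloisGroup (K ≃ₐ[F] K) (𝓞 F) (𝓞 K) := IsGaloisGroup.of_isFractionRing _ _ _ F K
  have := v.isMaximal
  apply Subtype.ext
  change v.asIdeal.map (algebraMap (𝓞 F) (𝓞 K)) = _
  rw [Ideal.map_algebraMap_eq_finsetProd_pow v.ne_bot, SubmonoidClass.coe_pow, orbitIdeal,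
    Submonoid.coe_finsetProd, ← Finset.prod_pow]
  symm
  refine Finset.prod_bij (fun P _ => P.asIdeal) ?_ (fun P _ Q _ h => HeightOneSpectrum.ext h) ?_ ?_
  · intro P hP
    rw [Set.Finite.mem_toFinset] at hP
    rw [Set.mem_toFinset]
    exact ⟨P.isPrime, ⟨congrArg (·.asIdeal) hP.symm⟩⟩
  · intro Q hQ
    rw [Set.mem_toFinset] at hQ
    refine ⟨⟨Q, hQ.1, Ideal.ne_bot_of_mem_primesOver v.ne_bot hQ⟩, ?_, rfl⟩
    rw [Set.Finite.mem_toFinset]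
    exact HeightOneSpectrum.ext hQ.2.over.symm
  · intro P hP
    rw [Set.Finite.mem_toFinset] at hP
    have hP : P.under (𝓞 F) = v := hP
    have : P.asIdeal.LiesOver v.asIdeal := ⟨congrArg (·.asIdeal) hP.symm⟩
    rw [Ideal.ramificationIdxIn_eq_ramificationIdx v.asIdeal P.asIdeal (K ≃ₐ[F] K)]
    rfl

theorem capitulationMap_mk0_prime [IsGalois F K] (v : HeightOneSpectrum (𝓞 F)) :
    Additive.ofMul (capitulationMap F K (ClassGroup.mk0 (primeIdeal F v))) =
      v.asIdeal.ramificationIdxIn (𝓞 K) •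
        Additive.ofMul (ClassGroup.mk0 (orbitIdeal F K v)) := by
  rw [ClassGroup.extendedHom_mk0, extendedIdeal_prime, map_pow, ofMul_pow]

/-- The classes which come from `F` are those of the ideals whose multiplicities are divisible by
the ramification indices. -/
theorem mem_range_capitulationMap_iff [IsGalois F K] (c : ClassGroup (𝓞 K)) :
    c ∈ (capitulationMap F K).range ↔ ∃ d : HeightOneSpectrum (𝓞 F) →₀ ℤ,
      (∀ v, (v.asIdeal.ramificationIdxIn (𝓞 K) : ℤ) ∣ d v) ∧
        orbitClass F K d = Additive.ofMul c := by
  constructor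
  · rintro ⟨b, rfl⟩
    obtain ⟨⟨I, hI⟩, rfl⟩ := ClassGroup.mk0_surjective b
    have hI0 : I ≠ 0 := nonZeroDivisors.ne_zero hI
    -- Every class has an integral representative, so it suffices to add one prime at a time; each
    -- contributes its ramification index to the vector.
    induction I using UniqueFactorizationMonoid.induction_on_prime with
    | h₁ => exact absurd rfl hI0
    | h₂ u hu =>
      refine ⟨0, fun _ => dvd_zero _, ?_⟩
      obtain rfl := Ideal.isUnit_iff.1 hu
      have : (⟨⊤, hI⟩ : (Ideal (𝓞 F))⁰) = 1 := Subtype.ext Ideal.one_eq_top.symm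
      rw [this, map_one, map_one, map_zero]
      rfl
    | h₃ I P hI' hP ih =>
      obtain ⟨d, hd, hdc⟩ := ih (mem_nonZeroDivisors_of_ne_zero hI') hI'
      let v : HeightOneSpectrum (𝓞 F) := ⟨P, Ideal.isPrime_of_prime hP, hP.ne_zero⟩
      refine ⟨Finsupp.single v (v.asIdeal.ramificationIdxIn (𝓞 K) : ℤ) + d, fun u => ?_, ?_⟩
      · classical
        rw [Finsupp.add_apply, Finsupp.single_apply]
        refine dvd_add ?_ (hd u)
        split_ifs with h
        · rw [h]
        · exact dvd_zero _
      · have : (⟨P * I, hI⟩ : (Ideal (𝓞 F))⁰) =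
          primeIdeal F v * ⟨I, mem_nonZeroDivisors_of_ne_zero hI'⟩ := rfl
        rw [this, map_mul, map_mul, ofMul_mul, map_add, hdc, orbitClass_single,
          capitulationMap_mk0_prime, natCast_zsmul]
  · rintro ⟨d, hd, hdc⟩
    suffices orbitClass F K d ∈ (capitulationMap F K).range.toAddSubgroup by rwa [hdc] at this
    rw [orbitClass_apply]
    refine sum_mem fun v _ => ?_
    obtain ⟨k, hk⟩ := hd v
    rw [hk, mul_comm, mul_smul, natCast_zsmul, ← capitulationMap_mk0_prime]
    refine zsmul_mem (S := AddSubgroup (Additive (ClassGroup (𝓞 K)))) ?_ k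
    change capitulationMap F K (ClassGroup.mk0 (primeIdeal F v)) ∈ (capitulationMap F K).range
    exact ⟨_, rfl⟩

end Generators

/-! ### Transgressive classes -/

section Transgression

variable (F K : Type) [Field F] [NumberField F] [Field K] [NumberField K] [Algebra F K]

/-- Hilbert's Theorem 90 for `Kˣ`. -/
theorem isZero_H1_units : Limits.IsZero
    (groupCohomology (Rep.ofMulDistribMulAction (K ≃ₐ[F] K) Kˣ) 1) := by
  have : Subsingleton (groupCohomology (Rep.ofMulDistribMulAction (K ≃ₐ[F] K) Kˣ) 1) :=
    @Unique.instSubsingleton _ (groupCohomology.H1ofAutOnUnitsUnique F K)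
  exact ModuleCat.isZero_of_subsingleton _

/-- The kernel of the connecting homomorphism in degree zero. -/
theorem δ_H0Iso_inv_eq_zero_iff {k G : Type} [CommRing k] [Group G] {X : ShortComplex (Rep.{0} k G)}
    (hX : X.ShortExact) (c : X.X₃.ρ.invariants) :
    groupCohomology.δ hX 0 1 rfl ((groupCohomology.H0Iso X.X₃).inv c) = 0 ↔
      ∃ y : X.X₂.ρ.invariants, X.g.hom y.1 = c.1 := by
  -- Naturality of `H0Iso`: on invariants, the map induced on `H⁰` is `X.g` itself.
  have hmap (y : X.X₂.ρ.invariants) (z : X.X₃.ρ.invariants) (hyz : X.g.hom y.1 = z.1) :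
      groupCohomology.map (MonoidHom.id G) X.g 0 ((groupCohomology.H0Iso X.X₂).inv y) =
        (groupCohomology.H0Iso X.X₃).inv z := by
    have h3 := ConcreteCategory.congr_hom (groupCohomology.map_id_comp_H0Iso_hom X.g)
      ((groupCohomology.H0Iso X.X₂).inv y)
    simp only [ConcreteCategory.comp_apply, Iso.inv_hom_id_apply] at h3
    have h4 : (Rep.invariantsFunctor k G).map X.g y = z := Subtype.ext hyz
    rw [h4] at h3
    rw [← h3, Iso.hom_inv_id_apply]
  constructor
  · intro h
    obtain ⟨y, hy⟩ := (ShortComplex.moduleCat_exact_iff _).1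
      (groupCohomology.mapShortComplex₃_exact hX (i := 0) (j := 1) rfl) _ h
    induction y using groupCohomology.H0_induction_on with | h y => ?_
    refine ⟨y, ?_⟩
    have h1 := (hmap y ((Rep.invariantsFunctor k G).map X.g y) rfl).symm.trans hy
    have h2 := congrArg (groupCohomology.H0Iso X.X₃).hom h1
    simp only [Iso.inv_hom_id_apply] at h2
    exact congrArg Subtype.val h2
  · rintro ⟨y, hy⟩
    rw [← hmap y c hy]
    exact ConcreteCategory.congr_hom
      (groupCohomology.mapShortComplex₃ hX (i := 0) (j := 1) rfl).zero _

/-- Hilbert 90 makes the second connecting map injective, so only the first matters; its kernel is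
the image of the invariant ideals. -/
theorem transgression_eq_zero_iff
    (c : (Rep.ofMulDistribMulAction (K ≃ₐ[F] K) (ClassGroup (𝓞 K))).ρ.invariants) :
    transgression F K c = 0 ↔
      ∃ I : IdealGroup K, (∀ g : K ≃ₐ[F] K, g • I = I) ∧
        Additive.ofMul (ClassGroup.mk K I) = c.1 := by
  have hinj : Function.Injective (groupCohomology.δ (unitSequence_shortExact F K) 1 2 rfl) :=
    (ModuleCat.mono_iff_injective _).1
      (groupCohomology.mono_δ_of_isZero (unitSequence_shortExact F K) 1 (isZero_H1_units F K))
  refine Iff.trans (map_eq_zero_iff (groupCohomology.δ (unitSequence_shortExact F K) 1 2 rfl).hom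
    hinj) (Iff.trans (δ_H0Iso_inv_eq_zero_iff (idealSequence_shortExact F K) c) ?_)
  exact ⟨fun ⟨y, hy⟩ => ⟨Additive.toMul y.1, fun g => y.2 g, hy⟩,
    fun ⟨I, hI, h⟩ => ⟨⟨Additive.ofMul I, fun g => hI g⟩, h⟩⟩

theorem mem_transgressiveClasses_iff_exists_invariant (c : ClassGroup (𝓞 K)) :
    c ∈ transgressiveClasses F K ↔
      ∃ I : IdealGroup K, (∀ g : K ≃ₐ[F] K, g • I = I) ∧ ClassGroup.mk K I = c := by
  rw [mem_transgressiveClasses]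
  constructor
  · rintro ⟨h, hc⟩
    exact (transgression_eq_zero_iff F K _).1 hc
  · rintro ⟨I, hI, rfl⟩
    exact ⟨fun g => by rw [smul_classGroup_mk, hI],
      (transgression_eq_zero_iff F K _).2 ⟨I, hI, rfl⟩⟩

end Transgression

/-! ### Local cohomology of units -/

section LocalCohomology

variable (F K : Type) [Field F] [NumberField F] [Field K] [NumberField K] [Algebra F K]
variable (v : HeightOneSpectrum (𝓞 F)) (w : HeightOneSpectrum (𝓞 K))
  [w.asIdeal.LiesOver v.asIdeal]

attribute [local instance] completionAlgebra completion_isScalarTower completion_continuousSMul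

theorem completion_finite : Module.Finite (v.adicCompletion F) (w.adicCompletion K) :=
  inferInstance

attribute [local instance] completion_finite

open scoped Valued in
-- A subspace of a finite-dimensional space over the complete field `F_v` is closed, and `K` is
-- dense in `K_w`.
theorem eq_top_of_range_algebraMap_le
    (S : Subalgebra (v.adicCompletion F) (w.adicCompletion K))
    (hS : ∀ x : K, algebraMap K (w.adicCompletion K) x ∈ S) : S = ⊤ := by
  have hclosed : IsClosed (S : Set (w.adicCompletion K)) :=
    (Subalgebra.toSubmodule S).closed_of_finiteDimensional
  have hdense : Dense (S : Set (w.adicCompletion K)) :=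
    (w.denseRange_algebraMap K).mono (by rintro _ ⟨x, rfl⟩; exact hS x)
  exact SetLike.coe_injective (hclosed.closure_eq.symm.trans hdense.closure_eq)

/-- If `K` is the splitting field of a separable `p` over `F`, the roots of `p` generate over `F_v`
an algebra containing `K`, hence all of `K_w`. -/
theorem isGalois_completion [IsGalois F K] :
    IsGalois (v.adicCompletion F) (w.adicCompletion K) := by
  obtain ⟨p, hsep, hp⟩ := IsGalois.is_separable_splitting_field F K
  let q := p.map (algebraMap F (v.adicCompletion F))
  have hmap : q.map (algebraMap (v.adicCompletion F) (w.adicCompletion K)) =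
      (p.map (algebraMap F K)).map (algebraMap K (w.adicCompletion K)) := by
    rw [Polynomial.map_map, Polynomial.map_map, ← IsScalarTower.algebraMap_eq,
      ← IsScalarTower.algebraMap_eq]
  have : q.IsSplittingField (v.adicCompletion F) (w.adicCompletion K) := by
    refine ⟨?_, eq_top_of_range_algebraMap_le F K v w _ fun x => ?_⟩
    · rw [hmap]
      exact hp.splits'.map _
    · have hx : x ∈ Algebra.adjoin F (p.rootSet K) := by
        rw [hp.adjoin_rootSet']
        trivial
      induction hx using Algebra.adjoin_induction with
      | mem y hy =>
        refine Algebra.subset_adjoin ?_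
        rw [Polynomial.mem_rootSet'] at hy ⊢
        refine ⟨?_, ?_⟩
        · rw [hmap]
          exact (Polynomial.map_ne_zero_iff (algebraMap K _).injective).2 hy.1
        · rw [← Polynomial.eval_map_algebraMap, hmap, Polynomial.eval_map_apply,
            Polynomial.eval_map_algebraMap, hy.2, map_zero]
      | algebraMap r =>
        rw [← IsScalarTower.algebraMap_apply, IsScalarTower.algebraMap_apply F (v.adicCompletion F)]
        exact Subalgebra.algebraMap_mem _ _
      | add x y _ _ hx hy =>
        rw [map_add]
        exact add_mem hx hy
      | mul x y _ _ hx hy =>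
        rw [map_mul]
        exact mul_mem hx hy
  exact IsGalois.of_separable_splitting_field (p := q) hsep.map

theorem exists_completionMap_eq [IsGalois F K] (x : w.adicCompletion K)
    (hx : ∀ σ : LocalGaloisGroup F K v w, σ x = x) : ∃ y, completionMap F K v w y = x := by
  have := isGalois_completion F K v w
  exact (IsGalois.mem_range_algebraMap_iff_fixed x).2 hx

theorem exists_valued_eq_exp_neg_one : ∃ π : Kˣ,
    Valued.v (algebraMap K (w.adicCompletion K) π) = WithZero.exp (-1 : ℤ) := by
  obtain ⟨π, hπ⟩ := w.valuation_exists_uniformizer K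
  have hπ0 : π ≠ 0 := by
    rintro rfl
    rw [map_zero] at hπ
    exact WithZero.exp_ne_zero hπ.symm
  refine ⟨Units.mk0 π hπ0, ?_⟩
  rw [← hπ]
  exact HeightOneSpectrum.valuedAdicCompletion_eq_valuation' w π

/-- The image in `K_w` of a uniformizer of `w` in `K`. -/
def localUniformizer : (w.adicCompletion K)ˣ :=
  Units.map (algebraMap K (w.adicCompletion K)).toMonoidHom
    (exists_valued_eq_exp_neg_one K w).choose

theorem valued_localUniformizer :
    Valued.v (localUniformizer K w : w.adicCompletion K) = WithZero.exp (-1 : ℤ) :=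
  (exists_valued_eq_exp_neg_one K w).choose_spec

variable {F K v w} in
-- Every `σ` preserves units and, by continuity, elements of valuation less than one. As the
-- valuation is discrete, it then preserves the valuation of a uniformizer, and any nonzero `x` is a
-- unit times a power of one.
theorem valued_localGalois (σ : LocalGaloisGroup F K v w) (x : w.adicCompletion K) :
    Valued.v (σ x) = Valued.v x := by
  have hint (τ : LocalGaloisGroup F K v w) {y : w.adicCompletion K} (hy : Valued.v y ≤ 1) :
      Valued.v (τ y) ≤ 1 :=
    (HeightOneSpectrum.mem_adicCompletionIntegers ..).1
      (localGalois_mem_integers τ ((HeightOneSpectrum.mem_adicCompletionIntegers ..).2 hy))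
  have hone (τ : LocalGaloisGroup F K v w) {y : w.adicCompletion K} (hy : Valued.v y = 1) :
      Valued.v (τ y) = 1 := by
    refine le_antisymm (hint τ hy.le) ?_
    have h := hint τ (y := y⁻¹) (by rw [map_inv₀, hy, inv_one])
    rw [map_inv₀, map_inv₀] at h
    have hy0 : y ≠ 0 := by
      rintro rfl
      simp at hy
    exact (inv_le_one₀ (zero_lt_iff.2 ((Valuation.ne_zero_iff _).2 ((map_ne_zero τ).2 hy0)))).1 h
  set ϖ : w.adicCompletion K := (localUniformizer K w).val
  have hϖ : Valued.v ϖ = WithZero.exp (-1 : ℤ) := valued_localUniformizer K w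
  have hϖ0 : ϖ ≠ 0 := Units.ne_zero _
  have hle (τ : LocalGaloisGroup F K v w) : Valued.v (τ ϖ) ≤ Valued.v ϖ := by
    have h : Valued.v (τ ϖ) < 1 := by
      refine valued_localGalois_lt_one τ ?_
      rw [hϖ, ← WithZero.exp_zero, WithZero.exp_lt_exp]
      norm_num
    have h0 : Valued.v (τ ϖ) ≠ 0 := (Valuation.ne_zero_iff _).2 ((map_ne_zero τ).2 hϖ0)
    rw [hϖ]
    rw [← WithZero.exp_log h0] at h ⊢
    rw [← WithZero.exp_zero, WithZero.exp_lt_exp] at h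
    rw [WithZero.exp_le_exp]
    lia
  -- By `hle` for the inverse, `σ⁻¹(ϖ)/ϖ` is integral; applying `σ` gives that `ϖ/σ(ϖ)` is integral.
  have hge : Valued.v ϖ ≤ Valued.v (σ ϖ) := by
    have h := hint σ (y := σ.symm ϖ / ϖ) (by
      rw [map_div₀]
      exact div_le_one_of_le₀ (hle σ.symm) zero_le)
    rw [map_div₀, AlgEquiv.apply_symm_apply, map_div₀] at h
    exact (div_le_one₀ (zero_lt_iff.2
      ((Valuation.ne_zero_iff _).2 ((map_ne_zero σ).2 hϖ0)))).1 h
  by_cases hx : x = 0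
  · rw [hx, map_zero]
  have hx0 : Valued.v x ≠ 0 := (Valuation.ne_zero_iff _).2 hx
  -- No sign is needed in the exponent, because `ϖ` has valuation `exp (-1)`.
  have hunit : Valued.v (x * ϖ ^ WithZero.log (Valued.v x)) = 1 := by
    rw [map_mul, map_zpow₀, hϖ, ← WithZero.exp_zsmul]
    conv_lhs => rw [← WithZero.exp_log hx0]
    rw [← WithZero.exp_add]
    simp
  have h := hone σ hunit
  rw [map_mul, map_mul, map_zpow₀, map_zpow₀, (hle σ).antisymm hge] at h
  rw [map_mul, map_zpow₀] at hunit
  exact mul_right_cancel₀ (zpow_ne_zero _ ((Valuation.ne_zero_iff _).2 hϖ0)) (h.trans hunit.symm)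

/-- Away from zero both sides are locally constant in `y`, so `y` may be replaced by a nearby
element of `F`, where the ramification formula is known. -/
theorem valued_completionMap (y : v.adicCompletion F) :
    Valued.v (completionMap F K v w y) =
      Valued.v y ^ v.asIdeal.ramificationIdx' w.asIdeal := by
  by_cases hy : y = 0
  · rw [hy, map_zero, map_zero, map_zero,
      zero_pow (Ideal.IsDedekindDomain.ramificationIdx'_ne_zero_of_liesOver w.asIdeal v.ne_bot)]
  have h1 : {z : v.adicCompletion F | Valued.v z = Valued.v y} ∈ nhds y :=
    Valued.locally_const ((Valuation.ne_zero_iff _).2 hy)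
  have h2 : {z : w.adicCompletion K | Valued.v z = Valued.v (completionMap F K v w y)} ∈
      nhds (completionMap F K v w y) :=
    Valued.locally_const ((Valuation.ne_zero_iff _).2 ((map_ne_zero _).2 hy))
  have h3 := (continuous_completionMap F K v w).continuousAt.preimage_mem_nhds h2
  obtain ⟨_, ⟨x, rfl⟩, hx1, hx2⟩ :=
    (v.denseRange_algebraMap F).inter_nhds_nonempty (Filter.inter_mem h1 h3)
  have hx2 : Valued.v (completionMap F K v w (algebraMap F _ x)) =
    Valued.v (completionMap F K v w y) := hx2
  have hx1 : Valued.v (algebraMap F (v.adicCompletion F) x) = Valued.v y := hx1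
  have hw : Valued.v (algebraMap K (w.adicCompletion K) (algebraMap F K x)) =
      w.valuation K (algebraMap F K x) :=
    HeightOneSpectrum.valuedAdicCompletion_eq_valuation' w (algebraMap F K x)
  have hv : Valued.v (algebraMap F (v.adicCompletion F) x) = v.valuation F x :=
    HeightOneSpectrum.valuedAdicCompletion_eq_valuation' v x
  rw [← hx1, ← hx2, completionMap_algebraMap, hw, hv]
  exact (HeightOneSpectrum.valuation_liesOver (K := F) K v w x).symm

end LocalCohomology

/-! ### Classes of local units as coboundaries of elements of `K_wˣ` -/

section LocalClass

variable (F K : Type) [Field F] [NumberField F] [Field K] [NumberField K] [Algebra F K]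
variable (v : HeightOneSpectrum (𝓞 F)) (w : HeightOneSpectrum (𝓞 K))
  [w.asIdeal.LiesOver v.asIdeal]

attribute [local instance] completionAlgebra completion_isScalarTower completion_continuousSMul
  completion_finite

variable {F K w} in
/-- An element of `K_w` of valuation one, as a local unit. -/
def localUnitOfValued (x : (w.adicCompletion K)ˣ) (hx : Valued.v (x : w.adicCompletion K) = 1) :
    LocalUnits K w where
  val := ⟨x, by rw [HeightOneSpectrum.mem_adicCompletionIntegers, hx]⟩
  inv := ⟨(x⁻¹ : (w.adicCompletion K)ˣ), by
    rw [HeightOneSpectrum.mem_adicCompletionIntegers, Units.val_inv_eq_inv_val, map_inv₀, hx,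
      inv_one]⟩
  val_inv := Subtype.ext x.mul_inv
  inv_val := Subtype.ext x.inv_mul

/-- The inclusion of the local units in `K_wˣ`. -/
def localUnitsVal : LocalUnits K w →* (w.adicCompletion K)ˣ :=
  Units.map (w.adicCompletionIntegers K).subtype.toMonoidHom

theorem localUnitsVal_injective : Function.Injective (localUnitsVal K w) :=
  Units.map_injective Subtype.val_injective

variable {K w} in
theorem localUnitsVal_localUnitOfValued (x : (w.adicCompletion K)ˣ)
    (hx : Valued.v (x : w.adicCompletion K) = 1) :
    localUnitsVal K w (localUnitOfValued x hx) = x := Units.ext rfl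

variable {K w} in
theorem valued_localUnitsVal (u : LocalUnits K w) :
    Valued.v (localUnitsVal K w u : w.adicCompletion K) = 1 :=
  HeightOneSpectrum.adicCompletionIntegers.isUnit_iff_valued_eq_one.1 u.isUnit

variable {F K v w} in
theorem localUnitsVal_smul (σ : LocalGaloisGroup F K v w) (u : LocalUnits K w) :
    localUnitsVal K w (σ • u) = σ • localUnitsVal K w u := Units.ext rfl

variable {F K v w} in
theorem valued_smul_div (σ : LocalGaloisGroup F K v w) (a : (w.adicCompletion K)ˣ) :
    Valued.v ((σ • a / a : (w.adicCompletion K)ˣ) : w.adicCompletion K) = 1 := by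
  rw [Units.val_div_eq_div_val, map_div₀]
  have h : Valued.v ((σ • a : (w.adicCompletion K)ˣ) : w.adicCompletion K) =
    Valued.v (a : w.adicCompletion K) := valued_localGalois σ a
  rw [h, div_self ((Valuation.ne_zero_iff _).2 a.ne_zero)]

variable {F K v w} in
-- The identity holds because the map is a coboundary in `K_wˣ`; it need not be one in the unit
-- group, and the failure is what `localClass` records.
theorem isMulCocycle₁_smul_div (a : (w.adicCompletion K)ˣ) :
    groupCohomology.IsMulCocycle₁ fun σ : LocalGaloisGroup F K v w =>
      localUnitOfValued (σ • a / a) (valued_smul_div σ a) := by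
  intro σ τ
  apply localUnitsVal_injective
  rw [map_mul, localUnitsVal_smul]
  simp only [localUnitsVal_localUnitOfValued]
  rw [smul_div', mul_smul, div_mul_div_cancel]

/-- The class of the cocycle `σ ↦ σ(a)/a` in `H¹(G_w, U_{K_w})`, for `a` in `K_wˣ`. -/
def localClass : Additive (w.adicCompletion K)ˣ →+ LocalH1 F K v w :=
  AddMonoidHom.mk' (fun a => groupCohomology.H1π _
    (groupCohomology.cocyclesOfIsMulCocycle₁ (isMulCocycle₁_smul_div a.toMul)))
    fun a b => by
      rw [← map_add]
      congr 1
      refine Subtype.ext (funext fun σ => ?_)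
      refine congrArg Additive.ofMul (localUnitsVal_injective K w ?_)
      refine Eq.trans ?_ (map_mul (localUnitsVal K w) _ _).symm
      simp only [localUnitsVal_localUnitOfValued]
      rw [toMul_add, smul_mul', mul_div_mul_comm]
      rfl

theorem H1π_eq_localClass
    (z : groupCohomology.cocycles₁
      (Rep.ofMulDistribMulAction (LocalGaloisGroup F K v w) (LocalUnits K w)))
    (a : (w.adicCompletion K)ˣ) (h : ∀ σ, localUnitsVal K w (Additive.toMul (z σ)) = σ • a / a) :
    groupCohomology.H1π _ z = localClass F K v w (Additive.ofMul a) := by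
  change _ = groupCohomology.H1π _ _
  congr 1
  refine Subtype.ext (funext fun σ => ?_)
  exact congrArg Additive.ofMul (localUnitsVal_injective K w
    ((h σ).trans (localUnitsVal_localUnitOfValued _ _).symm))

/-- Every class is a `localClass`, by Hilbert's Theorem 90 for `K_w/F_v`. -/
theorem localClass_surjective : Function.Surjective (localClass F K v w) := by
  intro c
  induction c using groupCohomology.H1_induction_on with | h z => ?_
  obtain ⟨a, ha⟩ :=
    groupCohomology.isMulCoboundary₁_of_isMulCocycle₁_of_aut_to_units
      (K := v.adicCompletion F) (L := w.adicCompletion K)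
      (fun σ => localUnitsVal K w (Additive.toMul (z σ)))
      (fun σ τ => by
        have hz := groupCohomology.isMulCocycle₁_of_mem_cocycles₁ _ z.2 σ τ
        exact (congrArg (localUnitsVal K w) hz).trans (map_mul _ _ _))
  exact ⟨Additive.ofMul a, (H1π_eq_localClass F K v w z a fun σ => (ha σ).symm).symm⟩

/-- The class of `a` is trivial if and only if `a` has the same valuation as an element of
`F_v`. -/
theorem localClass_eq_zero_iff [IsGalois F K] (a : (w.adicCompletion K)ˣ) :
    localClass F K v w (Additive.ofMul a) = 0 ↔
      ∃ y, Valued.v (completionMap F K v w y) = Valued.v (a : w.adicCompletion K) := by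
  have h1 : localClass F K v w (Additive.ofMul a) = 0 ↔
      ∃ u : LocalUnits K w, ∀ σ : LocalGaloisGroup F K v w,
        σ • localUnitsVal K w u / localUnitsVal K w u = σ • a / a := by
    refine (groupCohomology.H1π_eq_zero_iff _).trans ?_
    constructor
    · rintro ⟨u, hu⟩
      refine ⟨Additive.toMul u, fun σ => ?_⟩
      have h := congrArg (localUnitsVal K w) (congrArg Additive.toMul (congrFun hu σ))
      refine Eq.trans ?_ (h.trans (localUnitsVal_localUnitOfValued _ (valued_smul_div σ a)))
      rw [← localUnitsVal_smul, ← map_div]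
      rfl
    · rintro ⟨u, hu⟩
      refine ⟨Additive.ofMul u, funext fun σ => ?_⟩
      refine congrArg Additive.ofMul (localUnitsVal_injective K w ?_ : σ • u / u = _)
      rw [map_div, localUnitsVal_smul, hu]
      exact (localUnitsVal_localUnitOfValued _ _).symm
  rw [h1]
  constructor
  -- If `u` and `a` have the same coboundary, then `a/u` is fixed by `G_w` and so lies in `F_v`; it
  -- has the valuation of `a`.
  · rintro ⟨u, hu⟩
    obtain ⟨y, hy⟩ := exists_completionMap_eq F K v w
      ((a / localUnitsVal K w u : (w.adicCompletion K)ˣ) : w.adicCompletion K) fun σ => by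
        have h : σ • (a / localUnitsVal K w u) = a / localUnitsVal K w u := by
          rw [smul_div', div_eq_div_iff_div_eq_div, ← hu σ]
        exact congrArg Units.val h
    refine ⟨y, ?_⟩
    rw [hy, Units.val_div_eq_div_val, map_div₀, valued_localUnitsVal, div_one]
  · rintro ⟨y, hy⟩
    have hy0 : completionMap F K v w y ≠ 0 := by
      intro h
      rw [h, map_zero] at hy
      exact (Valuation.ne_zero_iff _).2 a.ne_zero hy.symm
    -- Dividing by `b`, which is fixed by `G_w`, turns `a` into a unit without changing its
    -- coboundary.
    let b := Units.mk0 _ hy0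
    have hb (σ : LocalGaloisGroup F K v w) : σ • b = b := Units.ext (σ.commutes y)
    refine ⟨localUnitOfValued (a / b) ?_, fun σ => ?_⟩
    · rw [Units.val_div_eq_div_val, map_div₀, ← hy]
      exact div_self ((Valuation.ne_zero_iff _).2 hy0)
    · rw [localUnitsVal_localUnitOfValued, smul_div', hb, div_div_div_cancel_right]

/-- The distinguished generator of `H¹(G_w, U_{K_w})`. -/
def localGenerator : LocalH1 F K v w :=
  localClass F K v w (Additive.ofMul (localUniformizer K w))

/-- The class depends only on the valuation: `a` divided by the `n`-th power of the uniformizer is a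
unit, so its class vanishes, with `1` as the witness in `F_v`. -/
theorem localClass_eq_zsmul [IsGalois F K] (a : (w.adicCompletion K)ˣ) (n : ℤ)
    (ha : Valued.v (a : w.adicCompletion K) = WithZero.exp (-n)) :
    localClass F K v w (Additive.ofMul a) = n • localGenerator F K v w := by
  rw [localGenerator, ← map_zsmul, ← sub_eq_zero, ← map_sub, ← ofMul_zpow, ← ofMul_div,
    localClass_eq_zero_iff]
  refine ⟨1, ?_⟩
  rw [map_one, map_one, Units.val_div_eq_div_val, map_div₀, ha, Units.val_zpow_eq_zpow_val,
    map_zpow₀, valued_localUniformizer, ← WithZero.exp_zsmul, ← WithZero.exp_sub]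
  simp

theorem zsmul_localGenerator_surjective [IsGalois F K] (c : LocalH1 F K v w) :
    ∃ n : ℤ, n • localGenerator F K v w = c := by
  obtain ⟨a, rfl⟩ := localClass_surjective F K v w c
  have h : Valued.v (a.toMul : w.adicCompletion K) ≠ 0 :=
    (Valuation.ne_zero_iff _).2 (Units.ne_zero _)
  refine ⟨-WithZero.log (Valued.v (a.toMul : w.adicCompletion K)), ?_⟩
  exact (localClass_eq_zsmul F K v w a.toMul _ (by rw [neg_neg, WithZero.exp_log h])).symm

/-- The multiple is the class of the `n`-th power of a uniformizer. It vanishes when `n` is attained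
as a valuation on `F_v`, and in `K_w` those values are the multiples of the ramification index. -/
theorem zsmul_localGenerator_eq_zero_iff [IsGalois F K] (n : ℤ) :
    n • localGenerator F K v w = 0 ↔ (v.asIdeal.ramificationIdxIn (𝓞 K) : ℤ) ∣ n := by
  have hgal : IsGaloisGroup (K ≃ₐ[F] K) (𝓞 F) (𝓞 K) := IsGaloisGroup.of_isFractionRing _ _ _ F K
  have := v.isMaximal
  have he : v.asIdeal.ramificationIdx' w.asIdeal = v.asIdeal.ramificationIdxIn (𝓞 K) := by
    rw [Ideal.ramificationIdx'_eq_ramificationIdx _ _ v.ne_bot,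
      Ideal.ramificationIdxIn_eq_ramificationIdx v.asIdeal w.asIdeal (K ≃ₐ[F] K)]
  rw [localGenerator, ← map_zsmul, ← ofMul_zpow, localClass_eq_zero_iff,
    Units.val_zpow_eq_zpow_val, map_zpow₀, valued_localUniformizer, ← WithZero.exp_zsmul]
  simp only [valued_completionMap, he]
  constructor
  · rintro ⟨y, hy⟩
    have hy0 : Valued.v y ≠ 0 := by
      intro h
      rw [h, zero_pow] at hy
      · exact WithZero.exp_ne_zero hy.symm
      · rw [← he]
        exact Ideal.IsDedekindDomain.ramificationIdx'_ne_zero_of_liesOver w.asIdeal v.ne_bot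
    rw [← WithZero.exp_log hy0, ← WithZero.exp_nsmul, WithZero.exp_inj] at hy
    refine ⟨-WithZero.log (Valued.v y), ?_⟩
    simp at hy
    linarith
  · rintro ⟨k, rfl⟩
    -- Every value is attained on `F_v`; raising this one to the ramification index gives the
    -- required valuation.
    obtain ⟨y, hy⟩ := v.valuedAdicCompletion_surjective F (WithZero.exp (-k))
    refine ⟨y, ?_⟩
    rw [hy, ← WithZero.exp_nsmul]
    congr 1
    simp

end LocalClass

/-! ### The cokernel of the localization map -/

section Cokernel

variable (F K : Type) [Field F] [NumberField F] [Field K] [NumberField K] [Algebra F K]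

attribute [local instance] completionAlgebra completion_isScalarTower completion_continuousSMul
  completion_finite

theorem under_eq_of_liesOver (v : HeightOneSpectrum (𝓞 F)) (w : HeightOneSpectrum (𝓞 K))
    [h : w.asIdeal.LiesOver v.asIdeal] : w.under (𝓞 F) = v :=
  HeightOneSpectrum.ext h.over.symm

variable {F K} in
theorem smul_toPrincipalIdeal_eq_iff (g : K ≃ₐ[F] K) (a : Kˣ) :
    g • toPrincipalIdeal (𝓞 K) K a = toPrincipalIdeal (𝓞 K) K a ↔
      ∃ u : (𝓞 K)ˣ, Units.map (algebraMap (𝓞 K) K).toMonoidHom u = g • a / a := by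
  rw [smul_toPrincipalIdeal, ← div_eq_one, ← map_div]
  have h := SetLike.ext_iff.1 (unitSequence_range_eq_ker K) (g • a / a)
  rw [MonoidHom.ker_rangeRestrict, MonoidHom.mem_ker] at h
  exact h.symm

variable {F K} in
-- Invariance of `(a)` says that each `g(a)/a` is a unit. With the converse
-- `exists_coboundary_of_cocycle`, from Hilbert 90, this describes `H¹(G, U_K)` by generators of
-- invariant principal ideals.
theorem exists_cocycle_of_invariant (a : Kˣ)
    (ha : ∀ g : K ≃ₐ[F] K, g • toPrincipalIdeal (𝓞 K) K a = toPrincipalIdeal (𝓞 K) K a) :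
    ∃ z : groupCohomology.cocycles₁ (Rep.ofMulDistribMulAction (K ≃ₐ[F] K) (𝓞 K)ˣ),
      ∀ g : K ≃ₐ[F] K, Units.map (algebraMap (𝓞 K) K).toMonoidHom
        (Additive.toMul (z g) : (𝓞 K)ˣ) = g • a / a := by
  choose u hu using fun g => (smul_toPrincipalIdeal_eq_iff g a).1 (ha g)
  refine ⟨groupCohomology.cocyclesOfIsMulCocycle₁ (f := u) fun g h => ?_, hu⟩
  apply Units.map_injective (f := (algebraMap (𝓞 K) K).toMonoidHom)
    (FaithfulSMul.algebraMap_injective (𝓞 K) K)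
  have hsmul : Units.map (algebraMap (𝓞 K) K).toMonoidHom (g • u h) =
    g • Units.map (algebraMap (𝓞 K) K).toMonoidHom (u h) := Units.ext rfl
  rw [map_mul, hsmul, hu, hu, hu, smul_div', mul_smul, div_mul_div_cancel]

variable {F K} in
theorem exists_coboundary_of_cocycle
    (z : groupCohomology.cocycles₁ (Rep.ofMulDistribMulAction (K ≃ₐ[F] K) (𝓞 K)ˣ)) :
    ∃ a : Kˣ, ∀ g : K ≃ₐ[F] K, Units.map (algebraMap (𝓞 K) K).toMonoidHom
        (Additive.toMul (z g) : (𝓞 K)ˣ) = g • a / a := by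
  obtain ⟨a, ha⟩ :=
    groupCohomology.isMulCoboundary₁_of_isMulCocycle₁_of_aut_to_units (K := F) (L := K)
      (fun g => Units.map (algebraMap (𝓞 K) K).toMonoidHom (Additive.toMul (z g)))
      (fun g h => by
        have hz := groupCohomology.isMulCocycle₁_of_mem_cocycles₁ _ z.2 g h
        exact (congrArg (Units.map (algebraMap (𝓞 K) K).toMonoidHom) hz).trans (map_mul _ _ _))
  exact ⟨a, fun g => (ha g).symm⟩

variable [IsGalois F K]

/-- The restricted cocycle is `σ ↦ σ(a)/a` with `a` seen in `K_w`, so its class is given by the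
valuation of `a` at `w`. -/
theorem localizationAt_H1π (v : HeightOneSpectrum (𝓞 F)) (w : HeightOneSpectrum (𝓞 K))
    [w.asIdeal.LiesOver v.asIdeal]
    (z : groupCohomology.cocycles₁ (Rep.ofMulDistribMulAction (K ≃ₐ[F] K) (𝓞 K)ˣ)) (a : Kˣ)
    (ha : ∀ g : K ≃ₐ[F] K, Units.map (algebraMap (𝓞 K) K).toMonoidHom
        (Additive.toMul (z g) : (𝓞 K)ˣ) = g • a / a) :
    localizationAt F K v w (groupCohomology.H1π _ z) =
      FractionalIdeal.count K w (toPrincipalIdeal (𝓞 K) K a : IdealGroup K) •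
        localGenerator F K v w := by
  let b : (w.adicCompletion K)ˣ := Units.map (algebraMap K (w.adicCompletion K)).toMonoidHom a
  have hb : Valued.v (b : w.adicCompletion K) = WithZero.exp
      (-FractionalIdeal.count K w (toPrincipalIdeal (𝓞 K) K a : IdealGroup K)) := by
    rw [← valuation_eq_exp_neg_count]
    exact HeightOneSpectrum.valuedAdicCompletion_eq_valuation' w (a : K)
  rw [← localClass_eq_zsmul F K v w b _ hb]
  change groupCohomology.map (restrictToGlobal F K v w) (unitsToLocalRep F K v w) 1
    (groupCohomology.H1π _ z) = _
  rw [groupCohomology.H1π_comp_map_apply]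
  refine H1π_eq_localClass F K v w _ b fun σ => ?_
  have h1 : localUnitsVal K w (unitsToLocal K w (Additive.toMul (z (restrictToGlobal F K v w σ)))) =
      Units.map (algebraMap K (w.adicCompletion K)).toMonoidHom
        (restrictToGlobal F K v w σ • a / a) := by
    rw [← ha]
    rfl
  have h2 : Units.map (algebraMap K (w.adicCompletion K)).toMonoidHom
      (restrictToGlobal F K v w σ • a) = σ • b :=
    Units.ext (algebraMap_restrictToGlobal F K v w σ a)
  rw [map_div, h2] at h1
  exact h1

variable (w : HeightOneSpectrum (𝓞 F) → HeightOneSpectrum (𝓞 K))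
  [∀ v, (w v).asIdeal.LiesOver v.asIdeal]

/-- The homomorphism which sends the basis vector at `v` to the distinguished generator of
`H¹(G_w, U_{K_w})`. -/
def generatorHom : (HeightOneSpectrum (𝓞 F) →₀ ℤ) →+
    ⨁ v : HeightOneSpectrum (𝓞 F), LocalH1 F K v (w v) := by
  classical
  exact Finsupp.liftAddHom fun v =>
    (DirectSum.of (fun v => LocalH1 F K v (w v)) v).comp
      (zmultiplesHom _ (localGenerator F K v (w v)))

theorem generatorHom_apply (d : HeightOneSpectrum (𝓞 F) →₀ ℤ) (v : HeightOneSpectrum (𝓞 F)) :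
    generatorHom F K w d v = d v • localGenerator F K v (w v) := by
  classical
  induction d using Finsupp.induction_linear with
  | zero => rw [map_zero, Finsupp.zero_apply, zero_smul]; rfl
  | add d d' hd hd' => rw [map_add, DirectSum.add_apply, hd, hd', Finsupp.add_apply, add_zsmul]
  | single u n =>
    rw [generatorHom, Finsupp.liftAddHom_apply_single, AddMonoidHom.comp_apply,
      zmultiplesHom_apply]
    by_cases h : u = v
    · subst h
      rw [DirectSum.of_eq_same, Finsupp.single_eq_same]
    · rw [DirectSum.of_eq_of_ne _ _ _ (Ne.symm h), Finsupp.single_eq_of_ne (Ne.symm h), zero_smul]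

theorem generatorHom_surjective : Function.Surjective (generatorHom F K w) := by
  classical
  intro x
  induction x using DirectSum.induction_on with
  | zero => exact ⟨0, map_zero _⟩
  | of v c =>
    obtain ⟨n, rfl⟩ := zsmul_localGenerator_surjective F K v (w v) c
    refine ⟨Finsupp.single v n, ?_⟩
    rw [generatorHom, Finsupp.liftAddHom_apply_single]
    rfl
  | add x y hx hy =>
    obtain ⟨d, rfl⟩ := hx
    obtain ⟨d', rfl⟩ := hy
    exact ⟨d + d', map_add _ _ _⟩

/-- Global classes correspond to elements `a` with `(a)` invariant, and the generator at `v` has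
order the ramification index, so equality in the direct sum is a congruence at each `v`. -/
theorem generatorHom_mem_range_localizationMap_iff (d : HeightOneSpectrum (𝓞 F) →₀ ℤ) :
    generatorHom F K w d ∈ (localizationMap F K w).range ↔
      ∃ a : Kˣ, (∀ g : K ≃ₐ[F] K,
          g • toPrincipalIdeal (𝓞 K) K a = toPrincipalIdeal (𝓞 K) K a) ∧
        ∀ v, (v.asIdeal.ramificationIdxIn (𝓞 K) : ℤ) ∣ d v -
          FractionalIdeal.count K (w v) (toPrincipalIdeal (𝓞 K) K a : IdealGroup K) := by
  have key (z : groupCohomology.cocycles₁ (Rep.ofMulDistribMulAction (K ≃ₐ[F] K) (𝓞 K)ˣ)) (a : Kˣ)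
      (ha : ∀ g : K ≃ₐ[F] K, Units.map (algebraMap (𝓞 K) K).toMonoidHom
        (Additive.toMul (z g) : (𝓞 K)ˣ) = g • a / a) :
      localizationMap F K w (groupCohomology.H1π _ z) = generatorHom F K w d ↔
        ∀ v, (v.asIdeal.ramificationIdxIn (𝓞 K) : ℤ) ∣ d v -
          FractionalIdeal.count K (w v) (toPrincipalIdeal (𝓞 K) K a : IdealGroup K) := by
    rw [DFunLike.ext_iff]
    refine forall_congr' fun v => ?_
    rw [localizationMap_apply, generatorHom_apply, localizationAt_H1π F K v (w v) z a ha,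
      ← zsmul_localGenerator_eq_zero_iff F K v (w v), sub_zsmul, add_neg_eq_zero, eq_comm]
  constructor
  · rintro ⟨c, hc⟩
    induction c using groupCohomology.H1_induction_on with | h z => ?_
    obtain ⟨a, ha⟩ := exists_coboundary_of_cocycle z
    exact ⟨a, fun g => (smul_toPrincipalIdeal_eq_iff g a).2 ⟨_, ha g⟩, (key z a ha).1 hc⟩
  · rintro ⟨a, ha, hd⟩
    obtain ⟨z, hz⟩ := exists_cocycle_of_invariant a ha
    exact ⟨_, (key z a hz).2 hd⟩

/-- An invariant `(a)` equals `orbitHom` of the vector of its multiplicities. Hence the class of `d`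
comes from `F` when subtracting such a vector leaves entries divisible by the ramification indices,
the same criterion as for the image of `λ`. -/
theorem orbitClass_mem_range_capitulationMap_iff (d : HeightOneSpectrum (𝓞 F) →₀ ℤ) :
    Additive.toMul (orbitClass F K d) ∈ (capitulationMap F K).range ↔
      ∃ a : Kˣ, (∀ g : K ≃ₐ[F] K,
          g • toPrincipalIdeal (𝓞 K) K a = toPrincipalIdeal (𝓞 K) K a) ∧
        ∀ v, (v.asIdeal.ramificationIdxIn (𝓞 K) : ℤ) ∣ d v -
          FractionalIdeal.count K (w v) (toPrincipalIdeal (𝓞 K) K a : IdealGroup K) := by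
  have hcount (d : HeightOneSpectrum (𝓞 F) →₀ ℤ) (a : Kˣ)
      (ha : orbitHom F K d = Additive.ofMul (toPrincipalIdeal (𝓞 K) K a))
      (v : HeightOneSpectrum (𝓞 F)) :
      FractionalIdeal.count K (w v) (toPrincipalIdeal (𝓞 K) K a : IdealGroup K) = d v := by
    rw [← countHom_apply, ← ha, countHom_orbitHom, under_eq_of_liesOver F K v (w v)]
  rw [mem_range_capitulationMap_iff]
  constructor
  · rintro ⟨d', hd', h⟩
    have h0 : orbitClass F K (d - d') = 0 := by
      rw [map_sub, h]
      exact sub_self _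
    obtain ⟨a, ha⟩ := (orbitClass_eq_zero_iff F K _).1 h0
    refine ⟨a, (exists_orbitHom_eq_iff F K _).1 ⟨_, ha⟩, fun v => ?_⟩
    rw [hcount _ a ha, Finsupp.sub_apply, sub_sub_cancel]
    exact hd' v
  · rintro ⟨a, ha, hd⟩
    obtain ⟨d', hd'⟩ := (exists_orbitHom_eq_iff F K _).2 ha
    refine ⟨d - d', fun v => ?_, ?_⟩
    · rw [Finsupp.sub_apply, ← hcount _ a hd']
      exact hd v
    · rw [map_sub, (orbitClass_eq_zero_iff F K d').2 ⟨a, hd'⟩, sub_zero]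
      rfl

/-- The homomorphism onto the Ostrowski quotient induced by `orbitClass`. -/
def orbitOstrowskiHom :
    (HeightOneSpectrum (𝓞 F) →₀ ℤ) →+ Additive (OstrowskiQuotient F K) :=
  AddMonoidHom.mk' (fun d => Additive.ofMul (QuotientGroup.mk
    ⟨Additive.toMul (orbitClass F K d), (mem_relativePolyaGroup_iff F K _).2 ⟨d, rfl⟩⟩))
    fun d d' => by
      rw [← ofMul_mul, ← QuotientGroup.mk_mul]
      congr 2
      exact Subtype.ext (congrArg Additive.toMul (map_add (orbitClass F K) d d'))

theorem orbitOstrowskiHom_surjective : Function.Surjective (orbitOstrowskiHom F K) := by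
  intro x
  obtain ⟨⟨c, hc⟩, hx⟩ := QuotientGroup.mk_surjective (Additive.toMul x)
  obtain ⟨d, hd⟩ := (mem_relativePolyaGroup_iff F K c).1 hc
  refine ⟨d, Additive.toMul.injective (Eq.trans ?_ hx)⟩
  exact congrArg QuotientGroup.mk (Subtype.ext hd)

/-- Both memberships reduce to the same existence statement about `a`, so the two surjections from
the free group have one kernel. -/
theorem ker_orbitOstrowskiHom :
    (orbitOstrowskiHom F K).ker =
      ((QuotientAddGroup.mk' (localizationMap F K w).range).comp (generatorHom F K w)).ker := by
  ext d
  rw [AddMonoidHom.mem_ker, AddMonoidHom.mem_ker, AddMonoidHom.comp_apply,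
    QuotientAddGroup.mk'_apply, QuotientAddGroup.eq_zero_iff,
    generatorHom_mem_range_localizationMap_iff,
    ← orbitClass_mem_range_capitulationMap_iff F K w d]
  exact (QuotientGroup.eq_one_iff (N := (capitulationMap F K).range.subgroupOf
    (relativePolyaGroup F K)) _).trans Subgroup.mem_subgroupOf

/-- The Ostrowski quotient is isomorphic to the cokernel of the localization map. -/
def ostrowskiQuotientEquiv :
    Additive (OstrowskiQuotient F K) ≃+ LocalizationCokernel F K w :=
  (QuotientAddGroup.quotientKerEquivOfSurjective _ (orbitOstrowskiHom_surjective F K)).symm.trans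
    ((QuotientAddGroup.quotientAddEquivOfEq (ker_orbitOstrowskiHom F K w)).trans
      (QuotientAddGroup.quotientKerEquivOfSurjective _
        ((QuotientAddGroup.mk'_surjective _).comp (generatorHom_surjective F K w))))

end Cokernel

end Ostrowski

end

theorem mainTheorem5 (F K : Type) [Field F] [NumberField F] [Field K] [NumberField K]
    [Algebra F K] [IsGalois F K]
    (w : HeightOneSpectrum (𝓞 F) → HeightOneSpectrum (𝓞 K))
    [∀ v, (w v).asIdeal.LiesOver v.asIdeal] :
    Ostrowski.relativePolyaGroup F K = Ostrowski.transgressiveClasses F K ∧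
      Nonempty (Additive (Ostrowski.OstrowskiQuotient F K) ≃+
        Ostrowski.LocalizationCokernel F K w) := by
  refine ⟨?_, ⟨Ostrowski.ostrowskiQuotientEquiv F K w⟩⟩
  ext c
  rw [Ostrowski.mem_relativePolyaGroup_iff_exists_invariant,
    Ostrowski.mem_transgressiveClasses_iff_exists_invariant]
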